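/- Fix a set $\mathcal P$ of predicate symbols, each with an arity $n\ge 0$, and an infinite set $\mathbf X$ of variables. A \emph{(constant-domain first-order Kripke) model} is $\mathcal M=(W,D,R,\rho)$ with $W,D\neq\emptyset$, $R\subseteq W^2$, and $\rho(P,w)\subseteq D^n$ for each $n$-ary $P\in\mathcal P$ and $w\in W$. It is an \emph{$S4.2$-model} if $R$ is reflexive, transitive and strongly convergent: for every $w$ there is $u$ such that $wRv$ implies $vRu$ for all $v$. Let $[\mathsf K_{\mathtt{wh}}]$ be one of four operator symbols $[\mathsf{tB}^{\mathtt{MS}}]$, $[\mathsf{tB}^{\mathtt{MS}}_{\mathtt{FS}}]$, $[\mathsf K^{\mathtt{MS}}]$, $[\mathsf K^{\mathtt{MS}}_{\mathtt{FS}}]$. The formulas of $\mathcal L([\mathsf K_{\mathtt{wh}}])$ are $$\phi ::= P(y_1,\dots,y_n)\mid \neg\phi\mid\phi\wedge\phi\mid[\mathsf K]\phi\mid[\mathsf K_{\mathtt{wh}}]^x\phi ,$$ where $[\mathsf K_{\mathtt{wh}}]^x$ binds $x$; $\mathcal L_\approx([\mathsf K_{\mathtt{wh}}])$ has in addition the atoms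 $x\approx y$. Put $\langle\mathsf K\rangle\phi:=\neg[\mathsf K]\neg\phi$ and $[\mathsf B]\phi:=\langle\mathsf K\rangle[\mathsf K]\phi$. Satisfaction $\mathcal M,w,\sigma\vDash\phi$ (with $\sigma:\mathbf X\to D$) is defined as usual for atoms, $\approx$ (equality on $D$), $\neg$, $\wedge$, and $[\mathsf K]$ (truth at all $R$-successors), while, writing $\phi(a)$ for the evaluation of $\phi$ under $\sigma[x\mapsto a]$, at $w$: \begin{itemize} \item $[\mathsf{tB}^{\mathtt{MS}}]^x\phi$ holds iff $[\mathsf B]\phi(a)\wedge\phi(a)$ for some $a\in D$; \item $[\mathsf{tB}^{\mathtt{MS}}_{\mathtt{FS}}]^x\phi$ holds iff $[\mathsf B]\phi(a)\wedge\phi(a)$ for some $a\in D$, and $[\mathsf B]\phi(b)\to\phi(b)$ for all $b\in D$; \item $[\mathsf K^{\mathtt{MS}}]^x\phi$ holds iff $[\mathsf K]\phi(a)$ for some $a\in D$; \item $[\mathsf K^{\mathtt{MS}}_{\mathtt{FS}}]^x\phi$ holds iff $[\mathsf K]\phi(a)$ for some $a\in D$, and $[\mathsf B]\phi(b)\to\phi(b)$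 for all $b\in D$. \end{itemize} Let $\mathbf{S4.2}^{[\mathsf K]}$ consist of all instances of propositional tautologies, the axioms $[\mathsf K](\phi\to\psi)\to([\mathsf K]\phi\to[\mathsf K]\psi)$, $[\mathsf K]\phi\to\phi$, $[\mathsf K]\phi\to[\mathsf K][\mathsf K]\phi$, $\langle\mathsf K\rangle[\mathsf K]\phi\to[\mathsf K]\langle\mathsf K\rangle\phi$, modus ponens, and necessitation for $[\mathsf K]$. Write $\phi[y/x]$ for the replacement of all free occurrences of $x$ in $\phi$ by $y$; whenever it is used, no free occurrence of $x$ in $\phi$ may lie in the scope of $[\mathsf K_{\mathtt{wh}}]^y$. Consider the axioms \begin{itemize} \item (TBtoKwh) $([\mathsf B]\phi\wedge\phi)[y/x]\to[\mathsf K_{\mathtt{wh}}]^x\phi$; \item (KtoKwh) $[\mathsf K]\phi[y/x]\to[\mathsf K_{\mathtt{wh}}]^x\phi$; \item (KwhtoFS) $[\mathsf K_{\mathtt{wh}}]^x\phi\to([\mathsf B]\phi\to\phi)[y/x]$; \item (BtoBKwh) $[\mathsf B]\phi[y/x]\to[\mathsf B][\mathsf K_{\mathtt{wh}}]^x\phi$,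 \end{itemize} and, writing $C(\chi)$ for $\psi_0\to[\mathsf K](\psi_1\to\cdots[\mathsf K](\psi_n\to\chi)\cdots)$ with $n\ge0$ and $x$ not free in any $\psi_i$, the rules \begin{itemize} \item (KwhtoTB) from $\vdash C(\neg([\mathsf B]\phi\wedge\phi))$ infer $\vdash C(\neg[\mathsf K_{\mathtt{wh}}]^x\phi)$; \item (KwhtoK) from $\vdash C(\neg[\mathsf K]\phi)$ infer $\vdash C(\neg[\mathsf K_{\mathtt{wh}}]^x\phi)$; \item (FS\&BtoKwh) from $\vdash C([\mathsf B]\phi\to\phi)$ infer $\vdash C([\mathsf B]\phi[y/x]\to[\mathsf K_{\mathtt{wh}}]^x\phi)$; \item (FS\&KtoKwh) from $\vdash C([\mathsf B]\phi\to\phi)$ infer $\vdash C([\mathsf K]\phi[y/x]\to[\mathsf K_{\mathtt{wh}}]^x\phi)$. \end{itemize} The logic $\mathbf{S4.2}^{[\mathsf K_{\mathtt{wh}}]}$ extends $\mathbf{S4.2}^{[\mathsf K]}$ (in the language $\mathcal L([\mathsf K_{\mathtt{wh}}])$) by: TBtoKwh and KwhtoTB, for $[\mathsf{tB}^{\mathtt{MS}}]$;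 KwhtoFS, BtoBKwh, KwhtoTB and FS\&BtoKwh, for $[\mathsf{tB}^{\mathtt{MS}}_{\mathtt{FS}}]$; KtoKwh and KwhtoK, for $[\mathsf K^{\mathtt{MS}}]$; KwhtoFS, BtoBKwh, KwhtoK and FS\&KtoKwh, for $[\mathsf K^{\mathtt{MS}}_{\mathtt{FS}}]$. The logic $\mathbf{S4.2}_\approx^{[\mathsf K_{\mathtt{wh}}]}$, in the language $\mathcal L_\approx([\mathsf K_{\mathtt{wh}}])$, has in addition the axioms $x\approx x$, $x\approx y\to(\phi[x/z]\to\phi[y/z])$ and $x\not\approx y\to[\mathsf K](x\not\approx y)$. For a set $\Gamma$ of formulas, $\Gamma\vdash\phi$ means that $\gamma_1\to(\cdots(\gamma_m\to\phi)\cdots)$ is a theorem of the logic for some $m\ge0$ and $\gamma_1,\dots,\gamma_m\in\Gamma$; and $\Gamma\vDash\phi$ means that $\mathcal M,w,\sigma\vDash\phi$ whenever $\mathcal M$ is an $S4.2$-model, $w$ a world, $\sigma$ an assignment, and $\mathcal M,w,\sigma\vDash\gamma$ for all $\gamma\in\Gamma$. \textbf{Theorem.} For each of the four operators $[\mathsf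 K_{\mathtt{wh}}]$, the logic $\mathbf{S4.2}^{[\mathsf K_{\mathtt{wh}}]}$ is sound and strongly complete with respect to the class of constant-domain $S4.2$-models: for all sets $\Gamma$ of $\mathcal L([\mathsf K_{\mathtt{wh}}])$-formulas and all $\mathcal L([\mathsf K_{\mathtt{wh}}])$-formulas $\phi$, $\Gamma\vdash\phi$ if and only if $\Gamma\vDash\phi$. The same holds for $\mathbf{S4.2}_\approx^{[\mathsf K_{\mathtt{wh}}]}$ and $\mathcal L_\approx([\mathsf K_{\mathtt{wh}}])$. -/

import Mathlib

universe u v w₁ w₂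

namespace KnowWh

/-- The four bundled operators `[tB^MS]`, `[tB^MS_FS]`, `[K^MS]`, `[K^MS_FS]`. -/
inductive WhOp : Type
  | tB
  | tBFS
  | K
  | KFS

/-- Formulas over a set `P` of predicate symbols with arities `ar` and a set `X` of variables.
`Formula ar X op false` is the language with `[K]` and the bundled operator `op`;
`Formula ar X op true` is the same language with identity. -/
inductive Formula {P : Type u} (ar : P → ℕ) (X : Type v) (op : WhOp) (ident : Bool) :
    Type (max u v)
  | atom (p : P) (t : Fin (ar p) → X) : Formula ar X op ident
  | eq (h : ident = true) (x y : X) : Formula ar X op ident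
  | neg (φ : Formula ar X op ident) : Formula ar X op ident
  | conj (φ ψ : Formula ar X op ident) : Formula ar X op ident
  | know (φ : Formula ar X op ident) : Formula ar X op ident
  | wh (x : X) (φ : Formula ar X op ident) : Formula ar X op ident

namespace Formula

variable {P : Type u} {ar : P → ℕ} {X : Type v} {op : WhOp} {ident : Bool}

/-- Material implication. -/
def imp (φ ψ : Formula ar X op ident) : Formula ar X op ident := neg (conj φ (neg ψ))

/-- `⟨K⟩ φ := ¬ [K] ¬ φ`. -/
def poss (φ : Formula ar X op ident) : Formula ar X op ident := neg (know (neg φ))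

/-- `[B] φ := ⟨K⟩ [K] φ`. -/
def bel (φ : Formula ar X op ident) : Formula ar X op ident := poss (know φ)

/-- Free variables; `wh x` binds `x`. -/
def FV : Formula ar X op ident → Set X
  | atom _ t => Set.range t
  | eq _ x y => {x, y}
  | neg φ => FV φ
  | conj φ ψ => FV φ ∪ FV ψ
  | know φ => FV φ
  | wh x φ => FV φ \ {x}

/-- `φ.subst x y` is `φ[y/x]`: every free occurrence of `x` is replaced by `y`. -/
def subst [DecidableEq X] (x y : X) : Formula ar X op ident → Formula ar X op ident
  | atom p t => atom p (fun i => if t i = x then y else t i)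
  | eq h a b => eq h (if a = x then y else a) (if b = x then y else b)
  | neg φ => neg (subst x y φ)
  | conj φ ψ => conj (subst x y φ) (subst x y ψ)
  | know φ => know (subst x y φ)
  | wh z φ => if z = x then wh z φ else wh z (subst x y φ)

/-- `φ.Admissible x y`: `y` is admissible for `x` in `φ`, i.e. no free occurrence of `x` in `φ`
lies in the scope of an operator binding `y`. -/
def Admissible (x y : X) : Formula ar X op ident → Prop
  | atom _ _ => True
  | eq _ _ _ => True
  | neg φ => Admissible x y φ
  | conj φ ψ => Admissible x y φ ∧ Admissible x y ψ
  | know φ => Admissible x y φ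
  | wh z φ => x ∉ FV (wh z φ) ∨ (z ≠ y ∧ Admissible x y φ)

/-- `chain ψ₀ [ψ₁, …, ψₙ] χ` is `ψ₀ → [K](ψ₁ → ⋯ [K](ψₙ → χ) ⋯)`. -/
def chain : Formula ar X op ident → List (Formula ar X op ident) → Formula ar X op ident →
    Formula ar X op ident
  | ψ, [], χ => imp ψ χ
  | ψ, ψ' :: l, χ => imp ψ (know (chain ψ' l χ))

/-- Instances of propositional tautologies: true under every valuation that respects the Boolean
connectives (all other formulas being treated as atoms). -/
def IsTautology (φ : Formula ar X op ident) : Prop :=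
  ∀ val : Formula ar X op ident → Prop,
    (∀ ψ, val (neg ψ) ↔ ¬ val ψ) → (∀ ψ χ, val (conj ψ χ) ↔ val ψ ∧ val χ) → val φ

end Formula

open Formula

/-- `Provable φ`: `φ` is a theorem of `S4.2^{op}` (for `ident = false`), respectively of
`S4.2_≈^{op}` (for `ident = true`). -/
inductive Provable {P : Type u} {ar : P → ℕ} {X : Type v} [DecidableEq X] {op : WhOp}
    {ident : Bool} : Formula ar X op ident → Prop
  -- the system S4.2 for `[K]`
  | taut (φ : Formula ar X op ident) : IsTautology φ → Provable φ
  | axK (φ ψ : Formula ar X op ident) :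
      Provable (imp (know (imp φ ψ)) (imp (know φ) (know ψ)))
  | axT (φ : Formula ar X op ident) : Provable (imp (know φ) φ)
  | ax4 (φ : Formula ar X op ident) : Provable (imp (know φ) (know (know φ)))
  | ax2 (φ : Formula ar X op ident) : Provable (imp (poss (know φ)) (know (poss φ)))
  | mp (φ ψ : Formula ar X op ident) : Provable (imp φ ψ) → Provable φ → Provable ψ
  | nec (φ : Formula ar X op ident) : Provable φ → Provable (know φ)
  -- axioms for the bundled operators
  | TBtoKwh (x y : X) (φ : Formula ar X op ident) :
      op = WhOp.tB → Admissible x y φ →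
      Provable (imp (subst x y (conj (bel φ) φ)) (wh x φ))
  | KtoKwh (x y : X) (φ : Formula ar X op ident) :
      op = WhOp.K → Admissible x y φ →
      Provable (imp (know (subst x y φ)) (wh x φ))
  | KwhtoFS (x y : X) (φ : Formula ar X op ident) :
      op = WhOp.tBFS ∨ op = WhOp.KFS → Admissible x y φ →
      Provable (imp (wh x φ) (subst x y (imp (bel φ) φ)))
  | BtoBKwh (x y : X) (φ : Formula ar X op ident) :
      op = WhOp.tBFS ∨ op = WhOp.KFS → Admissible x y φ →
      Provable (imp (bel (subst x y φ)) (bel (wh x φ)))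
  -- rules for the bundled operators
  | KwhtoTB (x : X) (φ ψ : Formula ar X op ident) (l : List (Formula ar X op ident)) :
      op = WhOp.tB ∨ op = WhOp.tBFS → (∀ χ ∈ ψ :: l, x ∉ FV χ) →
      Provable (chain ψ l (neg (conj (bel φ) φ))) →
      Provable (chain ψ l (neg (wh x φ)))
  | KwhtoK (x : X) (φ ψ : Formula ar X op ident) (l : List (Formula ar X op ident)) :
      op = WhOp.K ∨ op = WhOp.KFS → (∀ χ ∈ ψ :: l, x ∉ FV χ) →
      Provable (chain ψ l (neg (know φ))) →
      Provable (chain ψ l (neg (wh x φ)))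
  | FSBtoKwh (x y : X) (φ ψ : Formula ar X op ident) (l : List (Formula ar X op ident)) :
      op = WhOp.tBFS → Admissible x y φ → (∀ χ ∈ ψ :: l, x ∉ FV χ) →
      Provable (chain ψ l (imp (bel φ) φ)) →
      Provable (chain ψ l (imp (bel (subst x y φ)) (wh x φ)))
  | FSKtoKwh (x y : X) (φ ψ : Formula ar X op ident) (l : List (Formula ar X op ident)) :
      op = WhOp.KFS → Admissible x y φ → (∀ χ ∈ ψ :: l, x ∉ FV χ) →
      Provable (chain ψ l (imp (bel φ) φ)) →
      Provable (chain ψ l (imp (know (subst x y φ)) (wh x φ)))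
  -- identity axioms (only in the language with identity)
  | eqRefl (h : ident = true) (x : X) : Provable (eq h x x)
  | eqSubst (h : ident = true) (x y z : X) (φ : Formula ar X op ident) :
      Admissible z x φ → Admissible z y φ →
      Provable (imp (eq h x y) (imp (subst z x φ) (subst z y φ)))
  | neKnow (h : ident = true) (x y : X) :
      Provable (imp (neg (eq h x y)) (know (neg (eq h x y))))

/-- `Γ ⊢ φ`: there are `γ₁, …, γₘ ∈ Γ` such that `γ₁ → (γ₂ → ⋯ (γₘ → φ))` is a theorem. -/
def Derives {P : Type u} {ar : P → ℕ} {X : Type v} [DecidableEq X] {op : WhOp} {ident : Bool}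
    (Γ : Set (Formula ar X op ident)) (φ : Formula ar X op ident) : Prop :=
  ∃ l : List (Formula ar X op ident), (∀ γ ∈ l, γ ∈ Γ) ∧ Provable (l.foldr imp φ)

/-- First-order Kripke models with a constant domain. -/
structure KripkeModel {P : Type u} (ar : P → ℕ) : Type (max u (w₁ + 1) (w₂ + 1)) where
  W : Type w₁
  D : Type w₂
  nonempty_W : Nonempty W
  nonempty_D : Nonempty D
  R : W → W → Prop
  ρ : (p : P) → W → Set (Fin (ar p) → D)

namespace KripkeModel

variable {P : Type u} {ar : P → ℕ}

/-- For all `w` there is `u` such that every successor of `w` sees `u`. -/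
def StronglyConvergent (M : KripkeModel.{u, w₁, w₂} ar) : Prop :=
  ∀ w : M.W, ∃ u : M.W, ∀ v : M.W, M.R w v → M.R v u

/-- `S4.2`-models. -/
structure IsS42 (M : KripkeModel.{u, w₁, w₂} ar) : Prop where
  refl : ∀ w : M.W, M.R w w
  trans : ∀ w v u : M.W, M.R w v → M.R v u → M.R w u
  conv : M.StronglyConvergent

/-- Semantics of `[K]` on sets of worlds. -/
def Knows (M : KripkeModel.{u, w₁, w₂} ar) (p : M.W → Prop) (w : M.W) : Prop :=
  ∀ v : M.W, M.R w v → p v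

/-- Semantics of `[B] = ¬ [K] ¬ [K]` on sets of worlds. -/
def Believes (M : KripkeModel.{u, w₁, w₂} ar) (p : M.W → Prop) (w : M.W) : Prop :=
  ¬ M.Knows (fun v => ¬ M.Knows p v) w

/-- Semantics of the four bundled operators, applied to a property `p a v` of objects `a` at
worlds `v`. -/
def KnowsWh (M : KripkeModel.{u, w₁, w₂} ar) :
    WhOp → (M.D → M.W → Prop) → M.W → Prop
  | WhOp.tB, p, w => ∃ a : M.D, M.Believes (p a) w ∧ p a w
  | WhOp.tBFS, p, w =>
      (∃ a : M.D, M.Believes (p a) w ∧ p a w) ∧ ∀ b : M.D, M.Believes (p b) w → p b w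
  | WhOp.K, p, w => ∃ a : M.D, M.Knows (p a) w
  | WhOp.KFS, p, w =>
      (∃ a : M.D, M.Knows (p a) w) ∧ ∀ b : M.D, M.Believes (p b) w → p b w

variable {X : Type v} [DecidableEq X] {op : WhOp} {ident : Bool}

/-- `M.Sat φ w σ` is `M, w, σ ⊨ φ`. -/
def Sat (M : KripkeModel.{u, w₁, w₂} ar) :
    Formula ar X op ident → M.W → (X → M.D) → Prop
  | atom p t, w, σ => (fun i => σ (t i)) ∈ M.ρ p w
  | eq _ x y, _, σ => σ x = σ y
  | neg φ, w, σ => ¬ M.Sat φ w σ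
  | conj φ ψ, w, σ => M.Sat φ w σ ∧ M.Sat ψ w σ
  | know φ, w, σ => M.Knows (fun v => M.Sat φ v σ) w
  | wh x φ, w, σ => M.KnowsWh op (fun a v => M.Sat φ v (Function.update σ x a)) w

/-- The clause used for belief in `KnowsWh` is the satisfaction of the formula `[B] φ`. -/
theorem sat_bel (M : KripkeModel.{u, w₁, w₂} ar) (φ : Formula ar X op ident) (w : M.W)
    (σ : X → M.D) : M.Sat (bel φ) w σ ↔ M.Believes (fun v => M.Sat φ v σ) w :=
  Iff.rfl

end KripkeModel

/-- `Γ ⊨ φ` (local consequence) over the class of `S4.2` constant-domain models. -/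
def Entails {P : Type u} {ar : P → ℕ} {X : Type v} [DecidableEq X] {op : WhOp} {ident : Bool}
    (Γ : Set (Formula ar X op ident)) (φ : Formula ar X op ident) : Prop :=
  ∀ M : KripkeModel.{u, w₁, w₂} ar, M.IsS42 → ∀ (w : M.W) (σ : X → M.D),
    (∀ γ ∈ Γ, M.Sat γ w σ) → M.Sat φ w σ

end KnowWh

/-!
Soundness is an induction on derivations; the axioms and rules involving belief hold because every
world of an `S4.2` model sees a final world, where whatever was believed is known.

Weak completeness for a countable language uses a canonical model whose objects are variables. The
given formula has an equivalent whose bound variables form a finite set `B` disjoint from its free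
variables, so variables outside `B` can be substituted without capture. Because the rules of the
logic admit chains `C(χ)`, the theorems are closed, inside chains, under the infinitary rules that
derive `¬ wh x φ`, or `φ.attitude[z/x] → wh x φ`, from the relevant statements about all instances
`φ[y/x]` with `y ∉ B`. In a countable language a consistent theory with this closure property
extends to a maximal consistent set with the same property, as in the omitting types theorem, and
the formulas known at such a set inherit it; together this gives the truth lemma. Strong convergence
comes from a maximal consistent set containing everything believed, which inherits the closure
property because each infinitary rule is settled by what is believed. With identity, variables are
identified when the root says so, and every accessible world agrees.

A single formula involves finitely many symbols, so weak completeness in an arbitrary language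
reduces to a countable sublanguage. Strong completeness follows because entailment is compact, by
ultraproducts.
-/

namespace KnowWh

open Function Formula

/-- The operators `[tB^MS_FS]` and `[K^MS_FS]`, which also exclude false belief in any instance. -/
def WhOp.IsFS (op : WhOp) : Prop :=
  op = .tBFS ∨ op = .KFS

namespace Formula

/-! ### Formulas -/

variable {P : Type u} {ar : P → ℕ} {X : Type v} {op : WhOp} {ident : Bool}

/-- Bound variables: the variables `x` for which `wh x` occurs. -/
def BV : Formula ar X op ident → Set X
  | atom _ _ => ∅
  | eq _ _ _ => ∅
  | neg φ => BV φ
  | conj φ ψ => BV φ ∪ BV ψ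
  | know φ => BV φ
  | wh x φ => insert x (BV φ)

/-- Predicate symbols occurring in a formula. -/
def preds : Formula ar X op ident → Set P
  | atom p _ => {p}
  | eq _ _ _ => ∅
  | neg φ => preds φ
  | conj φ ψ => preds φ ∪ preds ψ
  | know φ => preds φ
  | wh _ φ => preds φ

/-- The attitude towards `φ` of which `wh x φ` asserts a mention-some instance: true belief for
`[tB^MS]` and `[tB^MS_FS]`, knowledge for `[K^MS]` and `[K^MS_FS]`. -/
def attitude : {op : WhOp} → Formula ar X op ident → Formula ar X op ident
  | .tB, φ | .tBFS, φ => conj (bel φ) φ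
  | .K, φ | .KFS, φ => know φ

/-- Classes of formulas closed under the primitive connectives other than `wh`. Semantic lemmas
proved by induction need only treat these and `wh`. -/
structure IsModallyClosed (Q : Formula ar X op ident → Prop) : Prop where
  neg {φ : Formula ar X op ident} : Q φ → Q (neg φ)
  conj {φ ψ : Formula ar X op ident} : Q φ → Q ψ → Q (conj φ ψ)
  know {φ : Formula ar X op ident} : Q φ → Q (know φ)

namespace IsModallyClosed

variable {Q : Formula ar X op ident → Prop} {φ ψ : Formula ar X op ident}

theorem imp (hQ : IsModallyClosed Q) (hφ : Q φ) (hψ : Q ψ) : Q (imp φ ψ) :=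
  hQ.neg (hQ.conj hφ (hQ.neg hψ))

theorem bel (hQ : IsModallyClosed Q) (hφ : Q φ) : Q (bel φ) :=
  hQ.neg (hQ.know (hQ.neg (hQ.know hφ)))

theorem attitude (hQ : IsModallyClosed Q) (hφ : Q φ) : Q φ.attitude := by
  cases op
  case tB | tBFS => exact hQ.conj (hQ.bel hφ) hφ
  case K | KFS => exact hQ.know hφ

end IsModallyClosed

theorem finite_FV (φ : Formula ar X op ident) : φ.FV.Finite := by
  induction φ with
  | atom p t => exact Set.finite_range t
  | wh x φ ih => exact ih.sdiff
  | _ => simp_all [FV]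

theorem finite_BV (φ : Formula ar X op ident) : φ.BV.Finite := by
  induction φ <;> simp_all [BV]

theorem finite_preds (φ : Formula ar X op ident) : φ.preds.Finite := by
  induction φ <;> simp_all [preds]

theorem admissible_of_notMem_BV {x y : X} {φ : Formula ar X op ident} (hy : y ∉ φ.BV) :
    Admissible x y φ := by
  induction φ <;> simp_all [BV, Admissible, Ne.symm]

theorem admissible_self (x : X) (φ : Formula ar X op ident) : Admissible x x φ := by
  induction φ with
  | wh z φ ih => grind [Admissible, FV]
  | _ => simp_all [Admissible]

/-- Gödel numbering, witnessing that a countable language has countably many formulas. -/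
def code [Encodable P] [Encodable X] : Formula ar X op ident → ℕ
  | atom p t => Nat.pair 0 (Encodable.encode (⟨p, t⟩ : Σ p, Fin (ar p) → X))
  | eq _ x y => Nat.pair 1 (Encodable.encode (x, y))
  | neg φ => Nat.pair 2 φ.code
  | conj φ ψ => Nat.pair 3 (Nat.pair φ.code ψ.code)
  | know φ => Nat.pair 4 φ.code
  | wh x φ => Nat.pair 5 (Nat.pair (Encodable.encode x) φ.code)

theorem code_injective [Encodable P] [Encodable X] :
    Injective (code : Formula ar X op ident → ℕ) := by
  intro φ
  induction φ with
  | atom p t =>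
    rintro (_ | _) h <;> simp only [code, Nat.pair_eq_pair, Encodable.encode_inj] at h
    all_goals grind
  | _ => rintro (_ | _) h <;> simp only [code, Nat.pair_eq_pair] at h <;> simp_all <;> grind

instance [Countable P] [Countable X] : Countable (Formula ar X op ident) :=
  have := Encodable.ofCountable P
  have := Encodable.ofCountable X
  code_injective.countable

theorem Admissible.attitude {x y : X} {φ : Formula ar X op ident} (h : Admissible x y φ) :
    Admissible x y φ.attitude := by
  cases op
  exacts [⟨h, h⟩, ⟨h, h⟩, h, h]

variable [DecidableEq X]

theorem subst_attitude (x y : X) (φ : Formula ar X op ident) :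
    φ.attitude.subst x y = (φ.subst x y).attitude := by
  cases op <;> rfl

theorem subst_of_notMem_FV {x y : X} {φ : Formula ar X op ident} (hx : x ∉ φ.FV) :
    φ.subst x y = φ := by
  induction φ with
  | atom p t =>
    simp only [subst]
    congr 1
    ext i
    exact if_neg fun h => hx ⟨i, h⟩
  | _ => grind [subst, FV]

theorem subst_self (x : X) (φ : Formula ar X op ident) : φ.subst x x = φ := by
  induction φ with
  | atom p t =>
    simp only [subst]
    congr 1
    ext i
    split_ifs with h
    exacts [h.symm, rfl]
  | _ => grind [subst]

theorem subst_subst_of_fresh {x z y : X} {φ : Formula ar X op ident} (hF : z ∉ φ.FV)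
    (hB : z ∉ φ.BV) : (φ.subst x z).subst z y = φ.subst x y := by
  induction φ with
  | atom p t => grind [subst, FV, BV]
  | _ => grind [subst, FV, BV, subst_of_notMem_FV]

theorem admissible_subst_of_fresh {x z : X} {φ : Formula ar X op ident} (hF : z ∉ φ.FV)
    (hB : z ∉ φ.BV) : Admissible z x (φ.subst x z) := by
  induction φ <;> grind [subst, FV, BV, Admissible]

theorem BV_subst (x y : X) (φ : Formula ar X op ident) : (φ.subst x y).BV = φ.BV := by
  induction φ <;> grind [subst, BV]

theorem FV_subst_subset (x y : X) (φ : Formula ar X op ident) :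
    (φ.subst x y).FV ⊆ insert y (φ.FV \ {x}) := by
  induction φ <;> grind [subst, FV]

theorem sizeOf_subst (x y : X) (φ : Formula ar X op ident) :
    sizeOf (φ.subst x y) = sizeOf φ := by
  induction φ with
  | eq => simp only [subst]; split_ifs <;> rfl
  | _ => grind [subst]

end Formula

/-! ### Translations between languages -/

universe u' v'

namespace Formula

variable {P : Type u} {ar : P → ℕ} {X : Type v} {op : WhOp} {ident : Bool} {Q : Type u'}
  {Y : Type v'} {f : Q → P} {g : Y → X}

/-- Translation along maps of predicate symbols and of variables. -/
def map (f : Q → P) (g : Y → X) :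
    Formula (fun q => ar (f q)) Y op ident → Formula ar X op ident
  | atom q t => atom (f q) fun i => g (t i)
  | eq h x y => eq h (g x) (g y)
  | neg φ => neg (map f g φ)
  | conj φ ψ => conj (map f g φ) (map f g ψ)
  | know φ => know (map f g φ)
  | wh x φ => wh (g x) (map f g φ)

theorem exists_map_eq {φ : Formula ar X op ident} (hpreds : φ.preds ⊆ Set.range f)
    (hFV : φ.FV ⊆ Set.range g) (hBV : φ.BV ⊆ Set.range g) : ∃ φ', map f g φ' = φ := by
  induction φ with
  | atom p t =>
    obtain ⟨q, rfl⟩ := hpreds rfl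
    choose t' ht' using fun i => hFV ⟨i, rfl⟩
    exact ⟨atom q t', by simp only [map, ht']⟩
  | eq h x y =>
    obtain ⟨x, rfl⟩ := hFV (.inl rfl)
    obtain ⟨y, rfl⟩ := hFV (.inr rfl)
    exact ⟨eq h x y, rfl⟩
  | neg φ ih =>
    obtain ⟨φ, rfl⟩ := ih hpreds hFV hBV
    exact ⟨neg φ, rfl⟩
  | conj φ ψ ih₁ ih₂ =>
    simp only [preds, FV, BV, Set.union_subset_iff] at hpreds hFV hBV
    obtain ⟨φ, rfl⟩ := ih₁ hpreds.1 hFV.1 hBV.1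
    obtain ⟨ψ, rfl⟩ := ih₂ hpreds.2 hFV.2 hBV.2
    exact ⟨conj φ ψ, rfl⟩
  | know φ ih =>
    obtain ⟨φ, rfl⟩ := ih hpreds hFV hBV
    exact ⟨know φ, rfl⟩
  | wh x φ ih =>
    simp only [FV, BV, Set.insert_subset_iff, Set.sdiff_singleton_subset_iff] at hFV hBV
    obtain ⟨⟨y, rfl⟩, hBV⟩ := hBV
    obtain ⟨φ, rfl⟩ := ih hpreds (hFV.trans (Set.insert_subset ⟨y, rfl⟩ subset_rfl)) hBV
    exact ⟨wh y φ, rfl⟩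

theorem FV_map (hg : g.Injective) (φ : Formula (fun q => ar (f q)) Y op ident) :
    (map f g φ).FV = g '' φ.FV := by
  induction φ with
  | atom q t => exact Set.range_comp g t
  | _ => simp_all [map, FV, Set.image_pair, Set.image_union, Set.image_sdiff hg]

theorem forall_notMem_FV_map (hg : g.Injective) {x : Y}
    {ψ : Formula (fun q => ar (f q)) Y op ident} {l : List (Formula (fun q => ar (f q)) Y op ident)}
    (hx : ∀ θ ∈ ψ :: l, x ∉ FV θ) :
    ∀ θ ∈ map f g ψ :: l.map (map f g), g x ∉ FV θ := by
  rw [← List.map_cons, List.forall_mem_map]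
  intro θ hθ
  rw [FV_map hg, hg.mem_set_image]
  exact hx θ hθ

theorem Admissible.map (hg : g.Injective) {x y : Y}
    {φ : Formula (fun q => ar (f q)) Y op ident} (hφ : Admissible x y φ) :
    Admissible (g x) (g y) (map f g φ) := by
  induction φ with
  | wh z φ ih =>
    refine hφ.imp (fun hx => ?_) fun hφ => ⟨hg.ne hφ.1, ih hφ.2⟩
    rw [← Formula.map, FV_map hg, hg.mem_set_image]
    exact hx
  | _ => simp_all [Admissible, Formula.map]

theorem map_imp (φ ψ : Formula (fun q => ar (f q)) Y op ident) :
    map f g (imp φ ψ) = imp (map f g φ) (map f g ψ) :=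
  rfl

theorem map_bel (φ : Formula (fun q => ar (f q)) Y op ident) :
    map f g (bel φ) = bel (map f g φ) :=
  rfl

theorem map_chain (ψ : Formula (fun q => ar (f q)) Y op ident) (l) (χ) :
    map f g (chain ψ l χ) = chain (map f g ψ) (l.map (map f g)) (map f g χ) := by
  induction l generalizing ψ with
  | nil => rfl
  | cons ψ' l ih => simp only [chain, map_imp, map, ih, List.map]

theorem map_subst [DecidableEq X] [DecidableEq Y] (hg : g.Injective) (x y : Y)
    (φ : Formula (fun q => ar (f q)) Y op ident) :
    map f g (φ.subst x y) = (map f g φ).subst (g x) (g y) := by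
  induction φ with
  | wh z φ ih =>
    simp only [map, subst, hg.eq_iff]
    split_ifs <;> simp only [map, ih]
  | _ => simp_all [map, subst, hg.eq_iff, apply_ite g]

end Formula

/-! ### Soundness -/

namespace KripkeModel

variable {P : Type u} {ar : P → ℕ} {X : Type v} [DecidableEq X] {op : WhOp} {ident : Bool}
  {M : KripkeModel.{u, w₁, w₂} ar} {φ ψ χ : Formula ar X op ident} {w : M.W} {σ : X → M.D}

theorem sat_imp : M.Sat (imp φ ψ) w σ ↔ (M.Sat φ w σ → M.Sat ψ w σ) := by
  simp [imp, Sat]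

theorem sat_wh {x : X} :
    M.Sat (wh x φ) w σ ↔ (∃ a, M.Sat φ.attitude w (update σ x a)) ∧
      (op.IsFS → ∀ a, M.Sat (imp (bel φ) φ) w (update σ x a)) := by
  cases op <;> simp [Sat, KnowsWh, attitude, WhOp.IsFS, sat_imp, sat_bel]

theorem sat_congr {τ : X → M.D} (h : ∀ x ∈ φ.FV, σ x = τ x) :
    M.Sat φ w σ ↔ M.Sat φ w τ := by
  induction φ generalizing w σ τ with
  | atom p t =>
    simp only [Sat, show (fun i => σ (t i)) = fun i => τ (t i) from funext fun i => h _ ⟨i, rfl⟩]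
  | eq e a b => simp only [Sat, h a (.inl rfl), h b (.inr rfl)]
  | neg φ ih => exact not_congr (ih h)
  | conj φ ψ ih₁ ih₂ =>
    exact and_congr (ih₁ fun x hx => h x (.inl hx)) (ih₂ fun x hx => h x (.inr hx))
  | know φ ih => exact forall₂_congr fun v _ => ih h
  | wh z φ ih =>
    have hupdate (a : M.D) : ∀ x ∈ φ.FV, update σ z a x = update τ z a x := fun x hx => by
      by_cases hxz : x = z
      · simp [hxz]
      · simpa [hxz] using h x ⟨hx, hxz⟩
    simp only [Sat, ih (hupdate _)]

theorem sat_update_of_notMem_FV {x : X} (hx : x ∉ φ.FV) (a : M.D) :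
    M.Sat φ w (update σ x a) ↔ M.Sat φ w σ :=
  sat_congr fun _ hy => update_of_ne (ne_of_mem_of_not_mem hy hx) a σ

theorem sat_subst {x y : X} (hφ : Admissible x y φ) :
    M.Sat (φ.subst x y) w σ ↔ M.Sat φ w (update σ x (σ y)) := by
  have hvar (σ : X → M.D) (z : X) : σ (if z = x then y else z) = update σ x (σ y) z := by
    by_cases hz : z = x <;> simp [hz]
  induction φ generalizing w σ with
  | atom p t => simp [Sat, subst, hvar]
  | eq e a b => simp [Sat, subst, hvar]
  | neg φ ih => exact not_congr (ih hφ)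
  | conj φ ψ ih₁ ih₂ => exact and_congr (ih₁ hφ.1) (ih₂ hφ.2)
  | know φ ih => exact forall₂_congr fun v _ => ih hφ
  | wh z φ ih =>
    by_cases hx : x ∈ (wh z φ).FV
    · obtain ⟨hzy, hφ⟩ := hφ.resolve_left (not_not.2 hx)
      have hxz : x ≠ z := fun h => hx.2 h
      simp only [subst, if_neg hxz.symm, Sat, ih hφ, update_of_ne hzy.symm, update_comm hxz]
    · rw [subst_of_notMem_FV hx, sat_update_of_notMem_FV hx]

theorem sat_attitude_subst {x y : X} (hφ : Admissible x y φ) :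
    M.Sat (φ.subst x y).attitude w σ ↔ M.Sat φ.attitude w (update σ x (σ y)) := by
  rw [← subst_attitude, sat_subst hφ.attitude]

theorem sat_chain_of_forall {x : X} {χ χ' ψ : Formula ar X op ident}
    {l : List (Formula ar X op ident)} (hx : ∀ θ ∈ ψ :: l, x ∉ FV θ)
    (h : ∀ v, (∀ a, M.Sat χ v (update σ x a)) → M.Sat χ' v σ)
    (hc : ∀ a, M.Sat (chain ψ l χ) w (update σ x a)) : M.Sat (chain ψ l χ') w σ := by
  induction l generalizing ψ w with
  | nil =>
    refine sat_imp.2 fun hψ => h w fun a => sat_imp.1 (hc a) ?_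
    exact (sat_update_of_notMem_FV (hx ψ (by simp)) a).2 hψ
  | cons ψ' l ih =>
    refine sat_imp.2 fun hψ v hv => ih (fun θ hθ => hx θ (.tail _ hθ)) fun a => ?_
    exact sat_imp.1 (hc a) ((sat_update_of_notMem_FV (hx ψ (by simp)) a).2 hψ) v hv

theorem sat_chain_neg_wh {x : X} {l : List (Formula ar X op ident)}
    (hx : ∀ θ ∈ ψ :: l, x ∉ FV θ)
    (h : ∀ a, M.Sat (chain ψ l (neg φ.attitude)) w (update σ x a)) :
    M.Sat (chain ψ l (neg (wh x φ))) w σ := by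
  refine sat_chain_of_forall hx (fun v hv hwh => ?_) h
  obtain ⟨a, ha⟩ := (sat_wh.1 hwh).1
  exact hv a ha

namespace IsS42

theorem exists_final (hM : M.IsS42) (w : M.W) :
    ∃ u, M.R w u ∧ ∀ v, M.R w v → M.R v u ∧ ∀ p, M.Believes p v → M.Knows p u := by
  obtain ⟨u, hu⟩ := hM.conv w
  refine ⟨u, hu w (hM.refl w), fun v hv => ⟨hu v hv, fun p hp => ?_⟩⟩
  obtain ⟨v', hvv', hp⟩ : ∃ v', M.R v v' ∧ M.Knows p v' := by
    simpa [Believes, Knows] using hp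
  exact fun t ht => hp t (hM.trans _ _ _ (hu v' (hM.trans _ _ _ hv hvv')) ht)

theorem sat_bel_of_know (hM : M.IsS42) (h : M.Sat (know φ) w σ) : M.Sat (bel φ) w σ :=
  fun hn => hn w (hM.refl w) h

theorem sat_attitude_of_know (hM : M.IsS42) (h : M.Sat (know φ) w σ) :
    M.Sat φ.attitude w σ := by
  cases op
  case tB | tBFS => exact ⟨hM.sat_bel_of_know h, h w (hM.refl w)⟩
  case K | KFS => exact h

theorem sat_know_poss_of_bel (hM : M.IsS42) (h : M.Sat (bel φ) w σ) :
    M.Sat (know (poss φ)) w σ := by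
  obtain ⟨u, -, hu⟩ := hM.exists_final w
  exact fun v hv hn => hn u (hu v hv).1 ((hu w (hM.refl w)).2 _ h u (hM.refl u))

/-- At a final successor of `w` every belief held there or later is true, and `φ` is known. -/
theorem sat_bel_wh_of_bel (hM : M.IsS42) {x : X} {a : M.D}
    (h : M.Sat (bel φ) w (update σ x a)) : M.Sat (bel (wh x φ)) w σ := by
  obtain ⟨u, hwu, hu⟩ := hM.exists_final w
  have hφ : M.Sat (know φ) u (update σ x a) := (hu w (hM.refl w)).2 _ h
  refine fun hn => hn u hwu fun v hv => sat_wh.2 ⟨⟨a, hM.sat_attitude_of_know ?_⟩, fun _ b => ?_⟩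
  · exact fun t ht => hφ t (hM.trans _ _ _ hv ht)
  · exact sat_imp.2 fun hb => (hu v (hM.trans _ _ _ hwu hv)).2 _ hb v hv

theorem sat_of_provable (hM : M.IsS42) (h : Provable φ) : M.Sat φ w σ := by
  induction h generalizing w σ with
  | taut _ h => exact h (M.Sat · w σ) (fun _ => Iff.rfl) fun _ _ => Iff.rfl
  | axK φ ψ =>
    exact sat_imp.2 fun h₁ => sat_imp.2 fun h₂ v hv => sat_imp.1 (h₁ v hv) (h₂ v hv)
  | axT φ => exact sat_imp.2 fun h => h w (hM.refl w)
  | ax4 φ => exact sat_imp.2 fun h v hv u hu => h u (hM.trans _ _ _ hv hu)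
  | ax2 φ => exact sat_imp.2 hM.sat_know_poss_of_bel
  | mp φ ψ _ _ ih₁ ih₂ => exact sat_imp.1 ih₁ ih₂
  | nec _ _ ih => exact fun _ _ => ih
  | TBtoKwh x y φ hop hφ =>
    subst hop
    exact sat_imp.2 fun h => ⟨σ y, (sat_attitude_subst hφ).1 h⟩
  | KtoKwh x y φ hop hφ =>
    subst hop
    exact sat_imp.2 fun h => ⟨σ y, (sat_attitude_subst hφ).1 h⟩
  | KwhtoFS x y φ hop hφ =>
    exact sat_imp.2 fun h => (sat_subst (φ := imp (bel φ) φ) ⟨hφ, hφ⟩).2 ((sat_wh.1 h).2 hop _)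
  | BtoBKwh x y φ _ hφ =>
    exact sat_imp.2 fun h => hM.sat_bel_wh_of_bel ((sat_subst (φ := bel φ) hφ).1 h)
  | KwhtoTB x φ ψ l hop hx _ ih =>
    rcases hop with rfl | rfl <;> exact sat_chain_neg_wh hx fun _ => ih
  | KwhtoK x φ ψ l hop hx _ ih =>
    rcases hop with rfl | rfl <;> exact sat_chain_neg_wh hx fun _ => ih
  | FSBtoKwh x y φ ψ l hop hφ hx _ ih =>
    refine sat_chain_of_forall hx (fun v hv => sat_imp.2 fun h => ?_) fun _ => ih
    replace h := (sat_subst (φ := bel φ) hφ).1 h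
    subst hop
    exact sat_wh.2 ⟨⟨σ y, h, sat_imp.1 (hv _) h⟩, fun _ => hv⟩
  | FSKtoKwh x y φ ψ l hop hφ hx _ ih =>
    refine sat_chain_of_forall hx (fun v hv => sat_imp.2 fun h => ?_) fun _ => ih
    subst hop
    exact sat_wh.2 ⟨⟨σ y, (sat_attitude_subst hφ).1 h⟩, fun _ => hv⟩
  | eqRefl _ x => rfl
  | eqSubst h x y z φ hx hy =>
    refine sat_imp.2 fun (hxy : σ x = σ y) => sat_imp.2 fun hφ => ?_
    rwa [sat_subst hy, ← hxy, ← sat_subst hx]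
  | neKnow h x y => exact sat_imp.2 fun h _ _ => h

end IsS42

theorem sat_foldr_imp {l : List (Formula ar X op ident)} :
    M.Sat (l.foldr imp φ) w σ ↔ ((∀ γ ∈ l, M.Sat γ w σ) → M.Sat φ w σ) := by
  induction l with
  | nil => simp
  | cons γ l ih => simp [sat_imp, ih]

end KripkeModel

theorem entails_of_derives {P : Type u} {ar : P → ℕ} {X : Type v} [DecidableEq X] {op : WhOp}
    {ident : Bool} {Γ : Set (Formula ar X op ident)} {φ : Formula ar X op ident}
    (h : Derives Γ φ) : Entails.{u, v, w₁, w₂} Γ φ := by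
  obtain ⟨l, hl, hφ⟩ := h
  exact fun M hM w σ hΓ =>
    KripkeModel.sat_foldr_imp.1 (hM.sat_of_provable hφ) fun γ hγ => hΓ γ (hl γ hγ)

/-! ### Theories and maximal consistent sets -/

variable {P : Type u} {ar : P → ℕ} {X : Type v} [DecidableEq X] {op : WhOp} {ident : Bool}
  {φ ψ χ χ' θ : Formula ar X op ident} {l : List (Formula ar X op ident)}
  {T w v : Set (Formula ar X op ident)}

/-- Sets of formulas containing all theorems and closed under modus ponens (but not necessarily
under necessitation). -/
structure IsTheory (T : Set (Formula ar X op ident)) : Prop where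
  thm {φ : Formula ar X op ident} : Provable φ → φ ∈ T
  mp {φ ψ : Formula ar X op ident} : imp φ ψ ∈ T → φ ∈ T → ψ ∈ T

/-- The theory generated by a theory `T` and a formula `θ`, described via the deduction theorem. -/
def adjoin (T : Set (Formula ar X op ident)) (θ : Formula ar X op ident) :
    Set (Formula ar X op ident) :=
  {φ | imp θ φ ∈ T}

theorem isTheory_provable : IsTheory {φ : Formula ar X op ident | Provable φ} :=
  ⟨id, .mp _ _⟩

namespace IsTheory

theorem of_taut (hT : IsTheory T) (h : IsTautology (imp φ ψ)) (hφ : φ ∈ T) : ψ ∈ T :=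
  hT.mp (hT.thm (.taut _ h)) hφ

theorem of_taut₂ (hT : IsTheory T) (h : IsTautology (imp φ (imp ψ χ))) (hφ : φ ∈ T)
    (hψ : ψ ∈ T) : χ ∈ T :=
  hT.mp (hT.of_taut h hφ) hψ

theorem eq_univ_of_neg_mem (hT : IsTheory T) (hφ : φ ∈ T) (hn : neg φ ∈ T) : T = Set.univ :=
  Set.eq_univ_of_forall fun _ =>
    hT.of_taut₂ (fun v hn hc => by simp only [imp, hn, hc]; tauto) hφ hn

theorem subset_adjoin (hT : IsTheory T) (θ : Formula ar X op ident) : T ⊆ adjoin T θ :=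
  fun _ => hT.of_taut fun v hn hc => by simp only [imp, hn, hc]; tauto

theorem self_mem_adjoin (hT : IsTheory T) (θ : Formula ar X op ident) : θ ∈ adjoin T θ :=
  hT.thm (.taut _ fun v hn hc => by simp only [imp, hn, hc]; tauto)

theorem adjoin (hT : IsTheory T) (θ : Formula ar X op ident) : IsTheory (adjoin T θ) where
  thm h := hT.subset_adjoin θ (hT.thm h)
  mp := hT.of_taut₂ fun v hn hc => by simp only [imp, hn, hc]; tauto

theorem adjoin_neg_ne_univ (hT : IsTheory T) (hφ : φ ∉ T) :
    KnowWh.adjoin T (neg φ) ≠ Set.univ := fun h =>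
  hφ (hT.of_taut (φ := imp (neg φ) φ) (fun v hn hc => by simp only [imp, hn, hc]; tauto)
    (h.symm ▸ Set.mem_univ φ : φ ∈ KnowWh.adjoin T (neg φ)))

theorem chain_conj_mem_iff (hT : IsTheory T) :
    chain (conj θ ψ) l χ ∈ T ↔ chain ψ l χ ∈ KnowWh.adjoin T θ := by
  cases l <;> constructor <;>
    exact fun h => hT.of_taut (fun v hn hc => by simp only [chain, imp, hn, hc]; tauto) h

end IsTheory

/-- Theories that do not contain every formula. -/
structure IsConsistentTheory (T : Set (Formula ar X op ident)) : Prop extends IsTheory T where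
  ne_univ : T ≠ Set.univ

/-- Maximal consistent sets. -/
def IsMCS (w : Set (Formula ar X op ident)) : Prop :=
  Maximal IsConsistentTheory w

namespace IsConsistentTheory

theorem neg_notMem (hT : IsConsistentTheory T) (hφ : φ ∈ T) : neg φ ∉ T := fun hn =>
  hT.ne_univ (hT.eq_univ_of_neg_mem hφ hn)

theorem sUnion {c : Set (Set (Formula ar X op ident))} (hne : c.Nonempty)
    (hdir : DirectedOn (· ⊆ ·) c) (hc : ∀ T ∈ c, IsConsistentTheory T) :
    IsConsistentTheory (⋃₀ c) where
  thm h := let ⟨T, hT⟩ := hne; ⟨T, hT, (hc T hT).thm h⟩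
  mp := by
    rintro φ ψ ⟨S, hS, h⟩ ⟨T, hT, hφ⟩
    obtain ⟨U, hU, hSU, hTU⟩ := hdir S hS T hT
    exact ⟨U, hU, (hc U hU).mp (hSU h) (hTU hφ)⟩
  ne_univ h := by
    obtain ⟨S, hS⟩ := hne
    obtain ⟨φ, -⟩ := (Set.ne_univ_iff_exists_notMem S).1 (hc S hS).ne_univ
    obtain ⟨S, hS, hφ⟩ : φ ∈ ⋃₀ c := h ▸ Set.mem_univ φ
    obtain ⟨T, hT, hn⟩ : neg φ ∈ ⋃₀ c := h ▸ Set.mem_univ (neg φ)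
    obtain ⟨U, hU, hSU, hTU⟩ := hdir S hS T hT
    exact (hc U hU).neg_notMem (hSU hφ) (hTU hn)

theorem exists_isMCS (hT : IsConsistentTheory T) : ∃ w, IsMCS w ∧ T ⊆ w := by
  obtain ⟨w, hTw, hw⟩ := zorn_subset_nonempty {T | IsConsistentTheory T}
    (fun c hc hchain hne =>
      ⟨⋃₀ c, sUnion hne hchain.directedOn hc, fun _ => Set.subset_sUnion_of_mem⟩) T hT
  exact ⟨w, hw, hTw⟩

end IsConsistentTheory

theorem IsTheory.mem_of_forall_isMCS (hT : IsTheory T) (h : ∀ w, IsMCS w → T ⊆ w → φ ∈ w) :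
    φ ∈ T := by
  by_contra hφ
  obtain ⟨w, hw, hTw⟩ :=
    IsConsistentTheory.exists_isMCS ⟨hT.adjoin (neg φ), hT.adjoin_neg_ne_univ hφ⟩
  exact hw.prop.neg_notMem (h w hw ((hT.subset_adjoin _).trans hTw)) (hTw (hT.self_mem_adjoin _))

/-- The formulas known in `w`. -/
def known (w : Set (Formula ar X op ident)) : Set (Formula ar X op ident) :=
  {φ | know φ ∈ w}

/-- The formulas believed in `w`. -/
def believed (w : Set (Formula ar X op ident)) : Set (Formula ar X op ident) :=
  {φ | bel φ ∈ w}

/-- The canonical accessibility relation between maximal consistent sets. -/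
def Acc (w v : Set (Formula ar X op ident)) : Prop :=
  known w ⊆ v

namespace IsMCS

theorem neg_mem (hw : IsMCS w) : neg φ ∈ w ↔ φ ∉ w := by
  refine ⟨fun hn hφ => hw.prop.neg_notMem hφ hn, fun hφ => ?_⟩
  have hadjoin : IsConsistentTheory (adjoin w (neg φ)) :=
    ⟨hw.prop.adjoin _, hw.prop.adjoin_neg_ne_univ hφ⟩
  exact hw.le_of_ge hadjoin (hw.prop.subset_adjoin _) (hw.prop.self_mem_adjoin _)

theorem conj_mem (hw : IsMCS w) : conj φ ψ ∈ w ↔ φ ∈ w ∧ ψ ∈ w := by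
  refine ⟨fun h => ⟨?_, ?_⟩, fun h => ?_⟩
  · exact hw.prop.of_taut (fun v hn hc => by simp only [imp, hn, hc]; tauto) h
  · exact hw.prop.of_taut (fun v hn hc => by simp only [imp, hn, hc]; tauto) h
  · exact hw.prop.of_taut₂ (fun v hn hc => by simp only [imp, hn, hc]; tauto) h.1 h.2

theorem imp_mem (hw : IsMCS w) : imp φ ψ ∈ w ↔ (φ ∈ w → ψ ∈ w) := by
  rw [imp, hw.neg_mem, hw.conj_mem, hw.neg_mem]
  tauto

theorem mem_of_provable_imp (hw : IsMCS w) (h : Provable (imp φ ψ)) (hφ : φ ∈ w) : ψ ∈ w :=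
  hw.prop.mp (hw.prop.thm h) hφ

end IsMCS

theorem provable_of_forall_isMCS (h : ∀ w, IsMCS w → φ ∈ w) : Provable φ :=
  isTheory_provable.mem_of_forall_isMCS fun w hw _ => h w hw

theorem provable_imp_of_forall_isMCS (h : ∀ w, IsMCS w → φ ∈ w → ψ ∈ w) : Provable (imp φ ψ) :=
  provable_of_forall_isMCS fun w hw => hw.imp_mem.2 (h w hw)

namespace IsMCS

theorem isTheory_known (hw : IsMCS w) : IsTheory (known w) where
  thm h := hw.prop.thm (.nec _ h)
  mp h := hw.prop.mp (hw.mem_of_provable_imp (.axK _ _) h)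

theorem acc_refl (hw : IsMCS w) : Acc w w :=
  fun _ h => hw.mem_of_provable_imp (.axT _) h

theorem know_know (hw : IsMCS w) (h : know φ ∈ w) : know (know φ) ∈ w :=
  hw.mem_of_provable_imp (.ax4 _) h

theorem acc_trans (hw : IsMCS w) {u : Set (Formula ar X op ident)} (hwv : Acc w v)
    (hvu : Acc v u) : Acc w u :=
  fun _ h => hvu (hwv (hw.know_know h))

theorem know_mem (hw : IsMCS w) : know φ ∈ w ↔ ∀ v, IsMCS v → Acc w v → φ ∈ v :=
  ⟨fun h _ _ hwv => hwv h, hw.isTheory_known.mem_of_forall_isMCS⟩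

theorem bel_mem (hw : IsMCS w) : bel φ ∈ w ↔ ∃ v, IsMCS v ∧ Acc w v ∧ know φ ∈ v := by
  rw [bel, poss, hw.neg_mem, hw.know_mem]
  push Not
  exact exists_congr fun v => and_congr_right fun hv => by rw [hv.neg_mem, not_not]

theorem bel_of_know (hw : IsMCS w) (h : know φ ∈ w) : bel φ ∈ w :=
  hw.bel_mem.2 ⟨w, hw, hw.acc_refl, h⟩

theorem bel_know (hw : IsMCS w) (h : bel φ ∈ w) : bel (know φ) ∈ w := by
  obtain ⟨v, hv, hwv, hφ⟩ := hw.bel_mem.1 h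
  exact hw.bel_mem.2 ⟨v, hv, hwv, hv.know_know hφ⟩

theorem bel_mem_iff_of_acc (hw : IsMCS w) (hv : IsMCS v) (hwv : Acc w v) :
    bel φ ∈ w ↔ bel φ ∈ v := by
  refine ⟨fun h => hwv (hw.mem_of_provable_imp (.ax2 (know φ)) (hw.bel_know h)), fun h => ?_⟩
  obtain ⟨u, hu, hvu, hφ⟩ := hv.bel_mem.1 h
  exact hw.bel_mem.2 ⟨u, hu, hw.acc_trans hwv hvu, hφ⟩

theorem isTheory_believed (hw : IsMCS w) : IsTheory (believed w) where
  thm h := hw.bel_of_know (hw.prop.thm (.nec _ h))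
  mp {φ ψ} h₁ h₂ := by
    obtain ⟨v, hv, hwv, h₁⟩ := hw.bel_mem.1 h₁
    obtain ⟨u, hu, hvu, h₂⟩ := hv.bel_mem.1 ((hw.bel_mem_iff_of_acc hv hwv).1 h₂)
    refine hw.bel_mem.2 ⟨u, hu, hw.acc_trans hwv hvu, ?_⟩
    exact hu.isTheory_known.mp (hvu (hv.know_know h₁)) h₂

theorem isConsistentTheory_believed (hw : IsMCS w) : IsConsistentTheory (believed w) where
  toIsTheory := hw.isTheory_believed
  ne_univ huniv := by
    obtain ⟨φ, -⟩ := (Set.ne_univ_iff_exists_notMem w).1 hw.prop.ne_univ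
    have hbel : bel (conj φ (neg φ)) ∈ w := huniv.ge (Set.mem_univ _)
    obtain ⟨v, hv, -, hφ⟩ := hw.bel_mem.1 hbel
    obtain ⟨hφ, hn⟩ := hv.conj_mem.1 (hv.acc_refl hφ)
    exact hv.neg_mem.1 hn hφ

theorem chain_mono (hw : IsMCS w) (h : know (imp χ χ') ∈ w) (hc : chain ψ l χ ∈ w) :
    chain ψ l χ' ∈ w := by
  induction l generalizing ψ w with
  | nil => exact hw.imp_mem.2 fun hψ => hw.prop.mp (hw.acc_refl h) (hw.imp_mem.1 hc hψ)
  | cons ψ' l ih =>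
    refine hw.imp_mem.2 fun hψ => hw.know_mem.2 fun v hv hwv => ?_
    exact ih hv (hwv (hw.know_know h)) (hwv (hw.imp_mem.1 hc hψ))

theorem chain_mem_of_know (hw : IsMCS w) (h : know χ ∈ w) : chain ψ l χ ∈ w := by
  induction l generalizing ψ w with
  | nil => exact hw.imp_mem.2 fun _ => hw.acc_refl h
  | cons ψ' l ih =>
    exact hw.imp_mem.2 fun _ => hw.know_mem.2 fun v hv hwv => ih hv (hwv (hw.know_know h))

end IsMCS

theorem Provable.chain_mono (h : Provable (imp χ χ')) (hc : Provable (chain ψ l χ)) :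
    Provable (chain ψ l χ') :=
  provable_of_forall_isMCS fun _ hw => hw.chain_mono (hw.prop.thm (.nec _ h)) (hw.prop.thm hc)

theorem Provable.imp_trans (h₁ : Provable (imp φ ψ)) (h₂ : Provable (imp ψ χ)) :
    Provable (imp φ χ) :=
  provable_imp_of_forall_isMCS fun _ hw hφ =>
    hw.mem_of_provable_imp h₂ (hw.mem_of_provable_imp h₁ hφ)

/-! ### The bundled operators, treated uniformly -/

theorem Provable.chain_of_provable (h : Provable χ) : Provable (chain ψ l χ) :=
  provable_of_forall_isMCS fun _ hw => hw.chain_mem_of_know (hw.prop.thm (.nec _ h))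

namespace IsMCS

theorem know_attitude (hw : IsMCS w) (h : know φ ∈ w) : know φ.attitude ∈ w := by
  cases op
  case tB | tBFS =>
    refine hw.know_mem.2 fun v hv hwv => hv.conj_mem.2 ⟨?_, hwv h⟩
    exact hv.bel_of_know (hwv (hw.know_know h))
  case K | KFS => exact hw.know_know h

theorem bel_attitude (hw : IsMCS w) (h : bel φ ∈ w) : bel φ.attitude ∈ w := by
  obtain ⟨v, hv, hwv, hφ⟩ := hw.bel_mem.1 h
  exact hw.bel_mem.2 ⟨v, hv, hwv, hv.know_attitude hφ⟩

theorem bel_of_attitude (hw : IsMCS w) (h : φ.attitude ∈ w) : bel φ ∈ w := by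
  cases op
  case tB | tBFS => exact (hw.conj_mem.1 h).1
  case K | KFS => exact hw.bel_of_know h

theorem know_neg_attitude (hw : IsMCS w) (h : bel φ ∉ w) : know (neg φ.attitude) ∈ w := by
  refine hw.know_mem.2 fun v hv hwv => hv.neg_mem.2 fun hφ => h ?_
  exact (hw.bel_mem_iff_of_acc hv hwv).2 (hv.bel_of_attitude hφ)

theorem attitude_mono (hw : IsMCS w) (h : Provable (imp φ ψ)) (hφ : φ.attitude ∈ w) :
    ψ.attitude ∈ w := by
  cases op
  case tB | tBFS =>
    obtain ⟨hb, hφ⟩ := hw.conj_mem.1 hφ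
    exact hw.conj_mem.2 ⟨hw.isTheory_believed.mp (hw.isTheory_believed.thm h) hb,
      hw.mem_of_provable_imp h hφ⟩
  case K | KFS => exact hw.isTheory_known.mp (hw.isTheory_known.thm h) hφ

end IsMCS

theorem provable_chain_neg_wh {x : X} (hx : ∀ θ ∈ ψ :: l, x ∉ FV θ)
    (h : Provable (chain ψ l (neg φ.attitude))) : Provable (chain ψ l (neg (wh x φ))) := by
  cases op
  · exact .KwhtoTB x φ ψ l (.inl rfl) hx h
  · exact .KwhtoTB x φ ψ l (.inr rfl) hx h
  · exact .KwhtoK x φ ψ l (.inl rfl) hx h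
  · exact .KwhtoK x φ ψ l (.inr rfl) hx h

theorem provable_attitude_imp_wh (hop : ¬ op.IsFS) {x y : X} (hφ : Admissible x y φ) :
    Provable (imp (φ.subst x y).attitude (wh x φ)) := by
  cases op
  · exact .TBtoKwh x y φ rfl hφ
  · exact absurd (.inl rfl) hop
  · exact .KtoKwh x y φ rfl hφ
  · exact absurd (.inr rfl) hop

theorem provable_chain_attitude_imp_wh {x y : X} (hφ : Admissible x y φ)
    (hx : ∀ θ ∈ ψ :: l, x ∉ FV θ) (h : op.IsFS → Provable (chain ψ l (imp (bel φ) φ))) :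
    Provable (chain ψ l (imp (φ.subst x y).attitude (wh x φ))) := by
  by_cases hop : op.IsFS
  · obtain rfl | rfl := hop
    · refine .chain_mono ?_ (.FSBtoKwh x y φ ψ l rfl hφ hx (h (.inl rfl)))
      exact .taut _ fun v hn hc => by simp only [attitude, imp, hn, hc]; tauto
    · exact .FSKtoKwh x y φ ψ l rfl hφ hx (h (.inr rfl))
  · exact (provable_attitude_imp_wh hop hφ).chain_of_provable

theorem provable_bel_imp_bel_wh {x y : X} (hφ : Admissible x y φ) :
    Provable (imp (bel (φ.subst x y)) (bel (wh x φ))) := by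
  by_cases hop : op.IsFS
  · exact .BtoBKwh x y φ hop hφ
  · exact provable_imp_of_forall_isMCS fun w hw h => hw.isTheory_believed.mp
      (hw.isTheory_believed.thm (provable_attitude_imp_wh hop hφ)) (hw.bel_attitude h)

/-- Provable equivalence. -/
def ProvEquiv (φ ψ : Formula ar X op ident) : Prop :=
  Provable (imp φ ψ) ∧ Provable (imp ψ φ)

/-- As `y` is not free in `wh x φ`, that formula can be the antecedent `ψ₀` in the rules for
`wh y ψ`; then `¬ wh y ψ` can be an antecedent in the rule for `wh x φ`. -/
theorem provable_wh_imp_wh {x y : X} (hy : y ∉ (wh x φ).FV) (hx : x ∉ (wh y ψ).FV)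
    (hφ : Admissible x y φ) (hψ : Admissible y x ψ) (h : ProvEquiv (φ.subst x y) ψ)
    (hφψ : Provable (imp φ (ψ.subst y x))) : Provable (imp (wh x φ) (wh y ψ)) := by
  have hfs (hop : op.IsFS) : Provable (chain (wh x φ) [] (imp (bel ψ) ψ)) :=
    provable_imp_of_forall_isMCS fun w hw hwh => hw.imp_mem.2 fun hb =>
      have hb := hw.isTheory_believed.mp (hw.isTheory_believed.thm h.2) hb
      hw.mem_of_provable_imp h.1
        (hw.imp_mem.1 (hw.mem_of_provable_imp (.KwhtoFS x y φ hop hφ) hwh) hb)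
  have hinst : Provable (chain (wh x φ) [] (imp (ψ.subst y x).attitude (wh y ψ))) :=
    provable_chain_attitude_imp_wh hψ (by simpa using hy) hfs
  have hneg : Provable (chain (conj (wh x φ) (neg (wh y ψ))) [] (neg φ.attitude)) :=
    provable_imp_of_forall_isMCS fun w hw hc => hw.neg_mem.2 fun ha => by
      obtain ⟨hwh, hn⟩ := hw.conj_mem.1 hc
      refine hw.neg_mem.1 hn (hw.imp_mem.1 (hw.mem_of_provable_imp hinst hwh) ?_)
      exact hw.attitude_mono hφψ ha
  have hnotFV : ∀ θ ∈ [conj (wh x φ) (neg (wh y ψ))], x ∉ FV θ := by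
    simpa [FV] using hx
  exact isTheory_provable.of_taut (fun v hn hc => by simp only [chain, imp, hn, hc]; tauto)
    (provable_chain_neg_wh hnotFV hneg)

namespace ProvEquiv

theorem refl (φ : Formula ar X op ident) : ProvEquiv φ φ :=
  ⟨provable_imp_of_forall_isMCS fun _ _ => id, provable_imp_of_forall_isMCS fun _ _ => id⟩

theorem trans (h : ProvEquiv φ ψ) (h' : ProvEquiv ψ χ) : ProvEquiv φ χ :=
  ⟨h.1.imp_trans h'.1, h'.2.imp_trans h.2⟩

theorem neg (h : ProvEquiv φ ψ) : ProvEquiv φ.neg ψ.neg :=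
  ⟨isTheory_provable.of_taut (fun v hn hc => by simp only [imp, hn, hc]; tauto) h.2,
    isTheory_provable.of_taut (fun v hn hc => by simp only [imp, hn, hc]; tauto) h.1⟩

theorem conj (h : ProvEquiv φ ψ) (h' : ProvEquiv χ χ') : ProvEquiv (φ.conj χ) (ψ.conj χ') :=
  ⟨isTheory_provable.of_taut₂ (fun v hn hc => by simp only [imp, hn, hc]; tauto) h.1 h'.1,
    isTheory_provable.of_taut₂ (fun v hn hc => by simp only [imp, hn, hc]; tauto) h.2 h'.2⟩

theorem know (h : ProvEquiv φ ψ) : ProvEquiv φ.know ψ.know :=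
  ⟨.mp _ _ (.axK _ _) (.nec _ h.1), .mp _ _ (.axK _ _) (.nec _ h.2)⟩

theorem wh (x : X) (h : ProvEquiv φ ψ) : ProvEquiv (wh x φ) (wh x ψ) := by
  have himp {φ ψ : Formula ar X op ident} (h : ProvEquiv φ ψ) :
      Provable (imp (.wh x φ) (.wh x ψ)) :=
    provable_wh_imp_wh (fun h => h.2 rfl) (fun h => h.2 rfl) (admissible_self x φ)
      (admissible_self x ψ) (by rwa [subst_self]) (by simpa [subst_self] using h.1)
  exact ⟨himp h, himp (And.symm h)⟩

theorem wh_rename (x : X) {z : X} (hF : z ∉ φ.FV) (hB : z ∉ φ.BV) :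
    ProvEquiv (.wh x φ) (.wh z (φ.subst x z)) := by
  have hz : z ∉ (Formula.wh x φ).FV := fun h => hF h.1
  have hx : x ∉ (Formula.wh z (φ.subst x z)).FV := fun h =>
    (FV_subst_subset x z φ h.1).elim h.2 fun hx => hx.2 rfl
  have hsubst : (φ.subst x z).subst z x = φ := by rw [subst_subst_of_fresh hF hB, subst_self]
  have hφ : Admissible x z φ := admissible_of_notMem_BV hB
  have hφ' : Admissible z x (φ.subst x z) := admissible_subst_of_fresh hF hB
  exact ⟨provable_wh_imp_wh hz hx hφ hφ' (refl _) (by simpa [hsubst] using (refl φ).1),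
    provable_wh_imp_wh hx hz hφ' hφ (by simpa [hsubst] using refl φ) (refl _).1⟩

end ProvEquiv

theorem exists_provEquiv_disjoint_BV [Infinite X] {A : Set X} (hA : A.Finite)
    (φ : Formula ar X op ident) : ∃ ψ, ψ.FV ⊆ φ.FV ∧ Disjoint ψ.BV A ∧ ProvEquiv φ ψ := by
  induction φ with
  | atom p t => exact ⟨_, subset_rfl, Set.empty_disjoint A, .refl _⟩
  | eq h a b => exact ⟨_, subset_rfl, Set.empty_disjoint A, .refl _⟩
  | neg φ ih =>
    obtain ⟨ψ, hF, hB, h⟩ := ih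
    exact ⟨neg ψ, hF, hB, h.neg⟩
  | conj φ φ' ih ih' =>
    obtain ⟨ψ, hF, hB, h⟩ := ih
    obtain ⟨ψ', hF', hB', h'⟩ := ih'
    exact ⟨conj ψ ψ', Set.union_subset_union hF hF', Set.disjoint_union_left.2 ⟨hB, hB'⟩,
      h.conj h'⟩
  | know φ ih =>
    obtain ⟨ψ, hF, hB, h⟩ := ih
    exact ⟨know ψ, hF, hB, h.know⟩
  | wh x φ ih =>
    obtain ⟨ψ, hF, hB, h⟩ := ih
    obtain ⟨z, hz⟩ := ((hA.union ψ.finite_FV).union ψ.finite_BV).exists_notMem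
    simp only [Set.mem_union, not_or] at hz
    obtain ⟨⟨hzA, hzF⟩, hzB⟩ := hz
    refine ⟨wh z (ψ.subst x z), ?_, ?_, (h.wh x).trans (.wh_rename x hzF hzB)⟩
    · rintro y ⟨hy, hyz⟩
      exact (FV_subst_subset x z ψ hy).elim (absurd · hyz) fun hy => ⟨hF hy.1, hy.2⟩
    · rw [BV, BV_subst]
      exact Set.disjoint_insert_left.2 ⟨hzA, hB⟩

/-! ### Henkin sets -/

/-- `WitnessRule B χ χ'` is an infinitary rule with premises `χ y` for `y ∉ B` and conclusion `χ'`: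
the two ways in which the instances of `φ` determine `wh x φ`. The set `B` reserves variables for
binding, so that every instance by a variable outside `B` is admissible. -/
inductive WitnessRule (B : Set X) : (X → Formula ar X op ident) → Formula ar X op ident → Prop
  | neg_wh (x : X) (φ : Formula ar X op ident) (hφ : φ.BV ⊆ B) :
      WitnessRule B (fun y => neg (φ.subst x y).attitude) (neg (wh x φ))
  | attitude_imp_wh (x z : X) (φ : Formula ar X op ident) (hφ : φ.BV ⊆ B) (hz : z ∉ B) :
      WitnessRule B (fun y => imp (bel (φ.subst x y)) (φ.subst x y))
        (imp (φ.subst x z).attitude (wh x φ))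

/-- Sets of formulas closed under the infinitary rules `WitnessRule B`, applied inside chains. -/
def IsHenkin (B : Set X) (T : Set (Formula ar X op ident)) : Prop :=
  ∀ ⦃χ χ'⦄, WitnessRule B χ χ' → ∀ ψ l, (∀ y ∉ B, chain ψ l (χ y) ∈ T) → chain ψ l χ' ∈ T

theorem countable_witnessRule [Countable P] [Countable X] (B : Set X) :
    {r : (X → Formula ar X op ident) × Formula ar X op ident |
      WitnessRule B r.1 r.2}.Countable := by
  refine .mono ?_ ((Set.countable_range fun i : X × Formula ar X op ident =>
      (fun y => neg (i.2.subst i.1 y).attitude, neg (wh i.1 i.2))).union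
    (Set.countable_range fun i : X × X × Formula ar X op ident =>
      (fun y => imp (bel (i.2.2.subst i.1 y)) (i.2.2.subst i.1 y),
        imp (i.2.2.subst i.1 i.2.1).attitude (wh i.1 i.2.2))))
  rintro ⟨χ, χ'⟩ (⟨x, φ, hφ⟩ | ⟨x, z, φ, hφ, hz⟩)
  · exact .inl ⟨(x, φ), rfl⟩
  · exact .inr ⟨(x, z, φ), rfl⟩

theorem isHenkin_provable [Infinite X] {B : Set X} (hB : B.Finite) :
    IsHenkin B {φ : Formula ar X op ident | Provable φ} := by
  have exists_fresh (φ ψ : Formula ar X op ident) (l : List (Formula ar X op ident)) :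
      ∃ z ∉ B, z ∉ φ.FV ∧ z ∉ φ.BV ∧ ∀ θ ∈ ψ :: l, z ∉ θ.FV := by
    have hfin : (⋃ θ ∈ {θ | θ ∈ ψ :: l}, θ.FV).Finite :=
      (List.finite_toSet _).biUnion fun θ _ => θ.finite_FV
    obtain ⟨z, hz⟩ :=
      (((hB.union φ.finite_FV).union φ.finite_BV).union hfin).exists_notMem
    exact ⟨z, by simp_all⟩
  rintro _ _ (⟨x, φ, hφ⟩ | ⟨x, y, φ, hφ, hy⟩) ψ l h
  all_goals
    obtain ⟨z, hzB, hzF, hzV, hzl⟩ := exists_fresh φ ψ l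
    have hrename := ProvEquiv.wh_rename x hzF hzV
  · exact hrename.neg.2.chain_mono (provable_chain_neg_wh hzl (h z hzB))
  · have hadm : Admissible z y (φ.subst x z) :=
      admissible_of_notMem_BV fun hmem => hy (hφ (BV_subst x z φ ▸ hmem))
    have himp := provable_chain_attitude_imp_wh hadm hzl fun _ => h z hzB
    rw [subst_subst_of_fresh hzF hzV] at himp
    refine Provable.chain_mono ?_ himp
    exact isTheory_provable.of_taut (fun v hn hc => by simp only [imp, hn, hc]; tauto) hrename.2

namespace IsHenkin

variable {B : Set X}

theorem adjoin (hH : IsHenkin B T) (hT : IsTheory T) (θ : Formula ar X op ident) :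
    IsHenkin B (adjoin T θ) := fun _ _ hrule ψ l h =>
  hT.chain_conj_mem_iff.1 (hH hrule (conj θ ψ) l fun y hy => hT.chain_conj_mem_iff.2 (h y hy))

theorem known (hH : IsHenkin B w) (hw : IsMCS w) : IsHenkin B (known w) := by
  intro χ χ' hrule ψ l h
  have htop : imp ψ ψ ∈ w := hw.imp_mem.2 id
  exact hw.imp_mem.1 (hH hrule (imp ψ ψ) (ψ :: l) fun y hy => hw.imp_mem.2 fun _ => h y hy) htop

theorem mem_of_forall (hH : IsHenkin B T) (hT : IsTheory T) {χ : X → Formula ar X op ident}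
    (hrule : WitnessRule B χ χ') (h : ∀ y ∉ B, χ y ∈ T) : χ' ∈ T :=
  hT.of_taut (φ := chain (imp χ' χ') [] χ')
    (fun v hn hc => by simp only [chain, imp, hn, hc]; tauto)
    (hH hrule _ [] fun y hy => hT.subset_adjoin _ (h y hy))

theorem exists_isMCS_isHenkin [Countable P] [Countable X] (hH : IsHenkin B T)
    (hT : IsConsistentTheory T) : ∃ w, IsMCS w ∧ IsHenkin B w ∧ T ⊆ w := by
  let S := {T : Set (Formula ar X op ident) // IsConsistentTheory T ∧ IsHenkin B T}
  let Rule := {r : (X → Formula ar X op ident) × Formula ar X op ident | WitnessRule B r.1 r.2}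
  have : Countable Rule := countable_witnessRule B
  have := Encodable.ofCountable (Rule × Formula ar X op ident × List (Formula ar X op ident))
  let decided (i : Rule × Formula ar X op ident × List (Formula ar X op ident)) :
      Order.Cofinal S :=
    { carrier := {T | chain i.2.1 i.2.2 i.1.1.2 ∈ T.1 ∨
        ∃ y ∉ B, neg (chain i.2.1 i.2.2 (i.1.1.1 y)) ∈ T.1}
      isCofinal := by
        obtain ⟨⟨⟨χ, χ'⟩, hrule⟩, ψ, l⟩ := i
        rintro ⟨T, hT, hH⟩
        by_cases h : ∀ y ∉ B, chain ψ l (χ y) ∈ T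
        · exact ⟨_, .inl (hH hrule ψ l h), le_rfl⟩
        · push Not at h
          obtain ⟨y, hy, h⟩ := h
          exact ⟨⟨_, ⟨hT.adjoin _, hT.adjoin_neg_ne_univ h⟩, hH.adjoin hT.toIsTheory _⟩,
            .inr ⟨y, hy, hT.self_mem_adjoin _⟩, hT.subset_adjoin _⟩ }
  let I := Order.idealOfCofinals (⟨T, hT, hH⟩ : S) decided
  have hunion : IsConsistentTheory (⋃₀ (Subtype.val '' (I : Set S))) :=
    .sUnion (I.nonempty.image _) (directedOn_image.2 I.directed)
      (by rintro _ ⟨T, -, rfl⟩; exact T.2.1)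
  obtain ⟨w, hw, hsub⟩ := hunion.exists_isMCS
  have hIw {T : S} (hT : T ∈ I) : T.1 ⊆ w := fun _ h => hsub ⟨_, ⟨T, hT, rfl⟩, h⟩
  refine ⟨w, hw, fun χ χ' hrule ψ l h => ?_, hIw (Order.mem_idealOfCofinals _ decided)⟩
  obtain ⟨T, hT, hTI⟩ := Order.cofinal_meets_idealOfCofinals (⟨T, hT, hH⟩ : S) decided
    (⟨(χ, χ'), hrule⟩, ψ, l)
  rcases hT with hT | ⟨y, hy, hT⟩
  · exact hIw hTI hT
  · exact absurd (h y hy) (hw.neg_mem.1 (hIw hTI hT))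

theorem mem_of_forall_isMCS [Countable P] [Countable X] (hH : IsHenkin B T) (hT : IsTheory T)
    (h : ∀ w, IsMCS w → IsHenkin B w → T ⊆ w → φ ∈ w) : φ ∈ T := by
  by_contra hφ
  obtain ⟨w, hw, hHw, hTw⟩ := (hH.adjoin hT (neg φ)).exists_isMCS_isHenkin
    ⟨hT.adjoin _, hT.adjoin_neg_ne_univ hφ⟩
  exact hw.prop.neg_notMem (h w hw hHw ((hT.subset_adjoin _).trans hTw))
    (hTw (hT.self_mem_adjoin _))

theorem of_believed_subset (hH : IsHenkin B w) (hw : IsMCS w) {u : Set (Formula ar X op ident)}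
    (hu : IsMCS u) (hwu : believed w ⊆ u) : IsHenkin B u := by
  have hknow {χ : Formula ar X op ident} (h : bel χ ∈ w) : know χ ∈ u := hwu (hw.bel_know h)
  rintro _ _ (⟨x, φ, hφ⟩ | ⟨x, z, φ, hφ, hz⟩) ψ l h
  · by_cases hb : ∃ y ∉ B, bel (φ.subst x y) ∈ w
    · obtain ⟨y, hy, hb⟩ := hb
      refine hu.chain_mono (hu.isTheory_known.of_taut ?_ (hknow (hw.bel_attitude hb))) (h y hy)
      exact fun v hn hc => by simp only [imp, hn, hc]; tauto
    · push Not at hb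
      exact hu.chain_mem_of_know <| hknow <| hw.bel_of_know <|
        (hH.known hw).mem_of_forall hw.isTheory_known (.neg_wh x φ hφ)
          fun y hy => hw.know_neg_attitude (hb y hy)
  · refine hu.chain_mem_of_know (hknow ?_)
    by_cases hb : bel (φ.subst x z) ∈ w
    · have hadm : Admissible x z φ := admissible_of_notMem_BV fun hmem => hz (hφ hmem)
      exact hw.isTheory_believed.of_taut (fun v hn hc => by simp only [imp, hn, hc]; tauto)
        (hw.mem_of_provable_imp (provable_bel_imp_bel_wh hadm) hb)
    · exact hw.isTheory_believed.of_taut (fun v hn hc => by simp only [imp, hn, hc]; tauto)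
        (hw.bel_of_know (hw.know_neg_attitude hb))

theorem exists_final (hH : IsHenkin B w) (hw : IsMCS w) :
    ∃ u, IsMCS u ∧ IsHenkin B u ∧ ∀ v, IsMCS v → Acc w v → Acc v u := by
  obtain ⟨u, hu, hwu⟩ := hw.isConsistentTheory_believed.exists_isMCS
  exact ⟨u, hu, hH.of_believed_subset hw hu hwu, fun v hv hwv φ hφ =>
    hwu (hw.bel_mem.2 ⟨v, hv, hwv, hφ⟩)⟩

theorem wh_mem (hH : IsHenkin B w) (hw : IsMCS w) {x : X} (hφ : φ.BV ⊆ B) :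
    wh x φ ∈ w ↔ (∃ y ∉ B, (φ.subst x y).attitude ∈ w) ∧
      (op.IsFS → ∀ y ∉ B, imp (bel (φ.subst x y)) (φ.subst x y) ∈ w) := by
  have hadm {y : X} (hy : y ∉ B) : Admissible x y φ := admissible_of_notMem_BV fun h => hy (hφ h)
  refine ⟨fun h => ⟨?_, fun hop y hy => ?_⟩, fun ⟨⟨z, hz, hatt⟩, hfs⟩ => ?_⟩
  · by_contra! hatt
    exact hw.neg_mem.1 (hH.mem_of_forall hw.prop.toIsTheory (.neg_wh x φ hφ)
      fun y hy => hw.neg_mem.2 (hatt y hy)) h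
  · exact hw.mem_of_provable_imp (.KwhtoFS x y φ hop (hadm hy)) h
  · by_cases hop : op.IsFS
    · exact hw.imp_mem.1 (hH.mem_of_forall hw.prop.toIsTheory (.attitude_imp_wh x z φ hφ hz)
        (hfs hop)) hatt
    · exact hw.mem_of_provable_imp (provable_attitude_imp_wh hop (hadm hz)) hatt

end IsHenkin

/-! ### The canonical model -/

/-- Identity of variables at `w`. In the language without identity distinct variables are never
identified, so that the definition makes sense for both languages. -/
def IsIdent (w : Set (Formula ar X op ident)) (x y : X) : Prop :=
  x = y ∨ ∃ h : ident = true, eq h x y ∈ w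

namespace IsMCS

variable {x y z : X}

theorem eq_mem_iff (hw : IsMCS w) {h : ident = true} : eq h x y ∈ w ↔ IsIdent w x y := by
  refine ⟨fun hxy => .inr ⟨h, hxy⟩, ?_⟩
  rintro (rfl | ⟨_, hxy⟩)
  exacts [hw.prop.thm (.eqRefl h x), hxy]

theorem subst_mem_of_isIdent (hw : IsMCS w) (hxy : IsIdent w x y) (hφ : φ.subst z x ∈ w)
    (hx : Admissible z x φ) (hy : Admissible z y φ) : φ.subst z y ∈ w := by
  obtain rfl | ⟨h, hxy⟩ := hxy
  · exact hφ
  · exact hw.prop.mp (hw.mem_of_provable_imp (.eqSubst h x y z φ hx hy) hxy) hφ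

variable [Infinite X]

theorem isIdent_symm (hw : IsMCS w) (hxy : IsIdent w x y) : IsIdent w y x := by
  obtain rfl | ⟨h, _⟩ := id hxy
  · exact .inl rfl
  · obtain ⟨z, hz⟩ := exists_ne x
    have hxx : (eq h z x).subst z x ∈ w := by simpa [subst] using hw.prop.thm (.eqRefl h x)
    have hyx := hw.subst_mem_of_isIdent hxy hxx trivial trivial
    exact (hw.eq_mem_iff (h := h)).1 (by simpa [subst, hz.symm] using hyx)

theorem isIdent_trans (hw : IsMCS w) (hxy : IsIdent w x y) (hyz : IsIdent w y z) :
    IsIdent w x z := by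
  obtain rfl | ⟨h, _⟩ := id hyz
  · exact hxy
  · obtain ⟨a, ha⟩ := exists_ne x
    have hxy' : (eq h x a).subst a y ∈ w := by
      simpa [subst, ha.symm] using hw.eq_mem_iff.2 hxy
    have hxz := hw.subst_mem_of_isIdent hyz hxy' trivial trivial
    exact (hw.eq_mem_iff (h := h)).1 (by simpa [subst, ha.symm] using hxz)

theorem isIdent_iff_of_acc (hw : IsMCS w) (hv : IsMCS v) (hwv : Acc w v) :
    IsIdent v x y ↔ IsIdent w x y := by
  constructor <;> rintro (hxy | ⟨h, hxy⟩)
  · exact .inl hxy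
  · refine .inr ⟨h, ?_⟩
    by_contra hne
    exact hv.neg_mem.1 (hwv (hw.mem_of_provable_imp (.neKnow h x y) (hw.neg_mem.2 hne))) hxy
  · exact .inl hxy
  · obtain ⟨z, hz⟩ := exists_ne x
    have hxx : (know (eq h x z)).subst z x ∈ w := by
      simpa [subst] using hw.prop.thm (.nec _ (.eqRefl h x))
    have hk := hw.subst_mem_of_isIdent (.inr ⟨h, hxy⟩) hxx trivial trivial
    exact .inr ⟨h, hwv (by simpa [subst, hz.symm, known] using hk)⟩

theorem atom_update_mem (hw : IsMCS w) {p : P} {s : Fin (ar p) → X} {i : Fin (ar p)}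
    (h : IsIdent w (s i) x) (hs : atom p s ∈ w) : atom p (update s i x) ∈ w := by
  obtain ⟨z, hz⟩ := (Set.finite_range s).exists_notMem
  have subst_update (a : X) :
      (atom p (update s i z) : Formula ar X op ident).subst z a = atom p (update s i a) := by
    simp only [subst]
    congr 1
    funext j
    by_cases hj : j = i
    · simp [hj]
    · simpa [hj] using fun h => absurd ⟨j, h⟩ hz
  rw [← subst_update]
  refine hw.subst_mem_of_isIdent h ?_ trivial trivial
  rwa [subst_update, update_eq_self]

theorem atom_mem_of_forall_isIdent (hw : IsMCS w) {p : P} {s t : Fin (ar p) → X}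
    (h : ∀ i, IsIdent w (s i) (t i)) (hs : atom p s ∈ w) : atom p t ∈ w := by
  have piecewise_mem (J : Finset (Fin (ar p))) : atom p (J.piecewise t s) ∈ w := by
    induction J using Finset.induction_on with
    | empty => simpa using hs
    | insert j J hj ih =>
      rw [Finset.piecewise_insert]
      exact hw.atom_update_mem (by simpa [hj] using h j) ih
  simpa using piecewise_mem Finset.univ

end IsMCS

section CanonicalModel

variable [Infinite X] {w₀ : Set (Formula ar X op ident)} {B : Set X}

/-- Identity at `w₀`, as an equivalence relation on the variables not reserved for binding. -/
def identSetoid (h₀ : IsMCS w₀) (B : Set X) : Setoid {x : X // x ∉ B} where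
  r a b := IsIdent w₀ a.1 b.1
  iseqv := ⟨fun _ => .inl rfl, h₀.isIdent_symm, h₀.isIdent_trans⟩

/-- The canonical model generated by the Henkin maximal consistent set `w₀`. Its objects are the
variables outside `B` up to identity at `w₀`; all worlds accessible from `w₀` agree on identity. -/
def canonicalModel (h₀ : IsMCS w₀) (hH₀ : IsHenkin B w₀) (hB : B.Finite) :
    KripkeModel.{u, max u v, v} ar where
  W := {w : Set (Formula ar X op ident) // IsMCS w ∧ IsHenkin B w ∧ Acc w₀ w}
  D := Quotient (identSetoid h₀ B)
  nonempty_W := ⟨⟨w₀, h₀, hH₀, h₀.acc_refl⟩⟩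
  nonempty_D := hB.exists_notMem.elim fun x hx => ⟨⟦⟨x, hx⟩⟧⟩
  R w v := Acc w.1 v.1
  ρ p w := {d | ∃ t : Fin (ar p) → {x : X // x ∉ B}, (∀ i, d i = ⟦t i⟧) ∧
    atom p (fun i => (t i).1) ∈ w.1}

variable {h₀ : IsMCS w₀} {hH₀ : IsHenkin B w₀} {hB : B.Finite}

theorem isS42_canonicalModel : (canonicalModel h₀ hH₀ hB).IsS42 where
  refl w := w.2.1.acc_refl
  trans w _ _ h₁ h₂ := w.2.1.acc_trans h₁ h₂
  conv w := by
    obtain ⟨u, hu, hHu, hfinal⟩ := w.2.2.1.exists_final w.2.1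
    refine ⟨⟨u, hu, hHu, ?_⟩, fun v hv => hfinal v.1 v.2.1 hv⟩
    exact h₀.acc_trans w.2.2.2 (hfinal _ w.2.1 w.2.1.acc_refl)

/-- The truth lemma for `φ` under the assignment `σ`. -/
def TruthLemma (σ : X → (canonicalModel h₀ hH₀ hB).D) (φ : Formula ar X op ident) : Prop :=
  ∀ w : (canonicalModel h₀ hH₀ hB).W, (canonicalModel h₀ hH₀ hB).Sat φ w σ ↔ φ ∈ w.1

namespace TruthLemma

variable {σ : X → (canonicalModel h₀ hH₀ hB).D}

theorem atom (hσ : ∀ a : {x // x ∉ B}, σ a = (⟦a⟧ : Quotient (identSetoid h₀ B))) {p : P}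
    {t : Fin (ar p) → X} (ht : ∀ i, t i ∉ B) : TruthLemma σ (.atom p t) := by
  have hσt (i : Fin (ar p)) : σ (t i) = (⟦⟨t i, ht i⟩⟧ : Quotient (identSetoid h₀ B)) :=
    hσ ⟨t i, ht i⟩
  refine fun w => ⟨fun ⟨s, hs, hmem⟩ => ?_, fun h => ⟨fun i => ⟨t i, ht i⟩, hσt, h⟩⟩
  refine w.2.1.atom_mem_of_forall_isIdent (fun i => ?_) hmem
  exact (h₀.isIdent_iff_of_acc w.2.1 w.2.2.2).2 (Quotient.exact ((hs i).symm.trans (hσt i)))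

theorem eq (hσ : ∀ a : {x // x ∉ B}, σ a = (⟦a⟧ : Quotient (identSetoid h₀ B)))
    {h : ident = true} {x y : X} (hx : x ∉ B) (hy : y ∉ B) : TruthLemma σ (.eq h x y) := by
  intro w
  rw [w.2.1.eq_mem_iff, h₀.isIdent_iff_of_acc w.2.1 w.2.2.2, KripkeModel.Sat, hσ ⟨x, hx⟩,
    hσ ⟨y, hy⟩]
  exact Quotient.eq

variable [Countable P] [Countable X]

theorem isModallyClosed : IsModallyClosed (TruthLemma σ) where
  neg hφ w := (not_congr (hφ w)).trans w.2.1.neg_mem.symm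
  conj hφ hψ w := (and_congr (hφ w) (hψ w)).trans w.2.1.conj_mem.symm
  know {φ} hφ w := by
    refine ⟨fun h => ?_, fun h v hv => (hφ v).2 (hv h)⟩
    refine (w.2.2.1.known w.2.1).mem_of_forall_isMCS w.2.1.isTheory_known fun v hv hHv hwv => ?_
    exact (hφ ⟨v, hv, hHv, h₀.acc_trans w.2.2.2 hwv⟩).1 (h _ hwv)

theorem wh (hσ : ∀ d, ∃ y ∉ B, σ y = d) {x : X} (hB' : φ.BV ⊆ B)
    (hφ : ∀ y ∉ B, TruthLemma σ (φ.subst x y)) : TruthLemma σ (wh x φ) := by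
  intro w
  have hadm {y : X} (hy : y ∉ B) : Admissible x y φ := admissible_of_notMem_BV fun h => hy (hB' h)
  have hatt {y : X} (hy : y ∉ B) : (canonicalModel h₀ hH₀ hB).Sat φ.attitude w
      (update σ x (σ y)) ↔ (φ.subst x y).attitude ∈ w.1 := by
    rw [← KripkeModel.sat_attitude_subst (hadm hy)]
    exact isModallyClosed.attitude (hφ y hy) w
  have himp {y : X} (hy : y ∉ B) : (canonicalModel h₀ hH₀ hB).Sat (imp (bel φ) φ) w
      (update σ x (σ y)) ↔ imp (bel (φ.subst x y)) (φ.subst x y) ∈ w.1 := by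
    rw [← KripkeModel.sat_subst (by simpa [imp, bel, poss, Admissible] using hadm hy)]
    exact isModallyClosed.imp (isModallyClosed.bel (hφ y hy)) (hφ y hy) w
  rw [KripkeModel.sat_wh, w.2.2.1.wh_mem w.2.1 hB']
  refine and_congr ⟨fun ⟨d, hd⟩ => ?_, fun ⟨y, hy, h⟩ => ⟨_, (hatt hy).2 h⟩⟩
    (imp_congr_right fun _ => ⟨fun h y hy => (himp hy).1 (h _), fun h d => ?_⟩) <;>
    obtain ⟨y, hy, rfl⟩ := hσ d
  · exact ⟨y, hy, (hatt hy).1 hd⟩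
  · exact (himp hy).2 (h y hy)

end TruthLemma

theorem truthLemma [Countable P] [Countable X] {σ : X → (canonicalModel h₀ hH₀ hB).D}
    (hσ : ∀ a : {x // x ∉ B}, σ a = (⟦a⟧ : Quotient (identSetoid h₀ B)))
    (φ : Formula ar X op ident) (hBV : φ.BV ⊆ B) (hFV : ∀ x ∈ φ.FV, x ∉ B) : TruthLemma σ φ :=
  match φ with
  | atom p t => .atom hσ fun i => hFV _ ⟨i, rfl⟩
  | eq h x y => .eq hσ (hFV x (.inl rfl)) (hFV y (.inr rfl))
  | neg φ => TruthLemma.isModallyClosed.neg (truthLemma hσ φ hBV hFV)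
  | conj φ ψ => TruthLemma.isModallyClosed.conj
      (truthLemma hσ φ (Set.subset_union_left.trans hBV) fun x hx => hFV x (.inl hx))
      (truthLemma hσ ψ (Set.subset_union_right.trans hBV) fun x hx => hFV x (.inr hx))
  | know φ => TruthLemma.isModallyClosed.know (truthLemma hσ φ hBV hFV)
  | wh x φ => by
    have hφB : φ.BV ⊆ B := (Set.subset_insert x _).trans hBV
    refine .wh (Quotient.mk_surjective.forall.2 fun a => ⟨a, a.2, hσ a⟩) hφB fun y hy => ?_
    refine truthLemma hσ (φ.subst x y) (BV_subst x y φ ▸ hφB) fun z hz => ?_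
    obtain rfl | hz := FV_subst_subset x y φ hz
    exacts [hy, hFV z hz]
  termination_by sizeOf φ
  decreasing_by all_goals simp [sizeOf_subst]; try lia

end CanonicalModel

theorem provable_of_entails_empty_of_countable [Infinite X] [Countable P] [Countable X]
    (hφ : Entails.{u, v, max u v, v} ∅ φ) : Provable φ := by
  obtain ⟨ψ, hFV, hdisj, hφψ, hψφ⟩ := exists_provEquiv_disjoint_BV φ.finite_FV φ
  refine .mp _ _ hψφ ?_
  refine (isHenkin_provable ψ.finite_BV).mem_of_forall_isMCS isTheory_provable fun w hw hH _ => ?_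
  have hM := isS42_canonicalModel (h₀ := hw) (hH₀ := hH) (hB := ψ.finite_BV)
  obtain ⟨σ, hσ⟩ : ∃ σ : X → (canonicalModel hw hH ψ.finite_BV).D,
      ∀ a : {x // x ∉ ψ.BV}, σ a = (⟦a⟧ : Quotient (identSetoid hw ψ.BV)) :=
    ⟨extend Subtype.val (Quotient.mk _) fun _ => (canonicalModel hw hH _).nonempty_D.some,
      Subtype.val_injective.extend_apply _ _⟩
  have hψ : ∀ x ∈ ψ.FV, x ∉ ψ.BV := fun x hx h => Set.disjoint_left.1 hdisj h (hFV hx)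
  refine (truthLemma hσ ψ subset_rfl hψ ⟨w, hw, hH, hw.acc_refl⟩).1 ?_
  exact KripkeModel.sat_imp.1 (hM.sat_of_provable hφψ) (hφ _ hM _ σ (by simp))

/-! ### Countable sublanguages -/

section Map

variable {Q : Type u'} {Y : Type v'} {f : Q → P} {g : Y → X}

theorem Provable.map [DecidableEq Y] (hg : g.Injective)
    {φ : Formula (fun q => ar (f q)) Y op ident} (hφ : Provable φ) :
    Provable (Formula.map f g φ) := by
  induction hφ with
  | taut φ h =>
    exact .taut _ fun v hn hc => h (fun ψ => v (ψ.map f g)) (fun _ => hn _) fun _ _ => hc _ _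
  | axK φ ψ => exact .axK _ _
  | axT φ => exact .axT _
  | ax4 φ => exact .ax4 _
  | ax2 φ => exact .ax2 _
  | mp φ ψ _ _ ih₁ ih₂ => exact .mp _ _ ih₁ ih₂
  | nec φ _ ih => exact .nec _ ih
  | TBtoKwh x y φ hop hφ =>
    rw [map_imp, map_subst hg]
    exact .TBtoKwh _ _ (φ.map f g) hop (hφ.map hg)
  | KtoKwh x y φ hop hφ =>
    rw [map_imp, Formula.map, map_subst hg]
    exact .KtoKwh _ _ (φ.map f g) hop (hφ.map hg)
  | KwhtoFS x y φ hop hφ =>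
    rw [map_imp, map_subst hg]
    exact .KwhtoFS _ _ (φ.map f g) hop (hφ.map hg)
  | BtoBKwh x y φ hop hφ =>
    rw [map_imp, map_bel, map_subst hg]
    exact .BtoBKwh _ _ (φ.map f g) hop (hφ.map hg)
  | KwhtoTB x φ ψ l hop hx _ ih =>
    rw [map_chain] at ih ⊢
    exact .KwhtoTB _ _ _ _ hop (forall_notMem_FV_map hg hx) ih
  | KwhtoK x φ ψ l hop hx _ ih =>
    rw [map_chain] at ih ⊢
    exact .KwhtoK _ _ _ _ hop (forall_notMem_FV_map hg hx) ih
  | FSBtoKwh x y φ ψ l hop hφ hx _ ih =>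
    rw [map_chain] at ih ⊢
    rw [map_imp, map_bel, map_subst hg]
    exact .FSBtoKwh _ _ _ _ _ hop (hφ.map hg) (forall_notMem_FV_map hg hx) ih
  | FSKtoKwh x y φ ψ l hop hφ hx _ ih =>
    rw [map_chain] at ih ⊢
    rw [map_imp, Formula.map, map_subst hg]
    exact .FSKtoKwh _ _ _ _ _ hop (hφ.map hg) (forall_notMem_FV_map hg hx) ih
  | eqRefl h x => exact .eqRefl h _
  | eqSubst h x y z φ hx hy =>
    rw [map_imp, map_imp, map_subst hg, map_subst hg]
    exact .eqSubst h _ _ _ _ (hx.map hg) (hy.map hg)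
  | neKnow h x y => exact .neKnow h _ _

namespace KripkeModel

/-- Expansion of a model along an injective map of predicate symbols; the symbols outside the range
are interpreted by the empty relation. -/
def expand (f : Q → P) (M : KripkeModel.{u', w₁, w₂} fun q => ar (f q)) :
    KripkeModel.{u, w₁, w₂} ar where
  W := M.W
  D := M.D
  nonempty_W := M.nonempty_W
  nonempty_D := M.nonempty_D
  R := M.R
  ρ p w := {d | ∃ q, ∃ h : f q = p, (fun i => d (Fin.cast (congrArg ar h) i)) ∈ M.ρ q w}

variable {M : KripkeModel.{u', w₁, w₂} fun q => ar (f q)}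

theorem IsS42.expand (hM : M.IsS42) : (M.expand f).IsS42 :=
  ⟨hM.refl, hM.trans, hM.conv⟩

theorem sat_expand_map [DecidableEq Y] (hf : f.Injective) (hg : g.Injective)
    {φ : Formula (fun q => ar (f q)) Y op ident} {w : M.W} {σ : X → M.D} :
    (M.expand f).Sat (φ.map f g) w σ ↔ M.Sat φ w (σ ∘ g) := by
  induction φ generalizing w σ with
  | atom q t =>
    refine ⟨fun ⟨q', hq, h⟩ => ?_, fun h => ⟨q, rfl, h⟩⟩
    obtain rfl := hf hq
    exact h
  | eq h x y => exact Iff.rfl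
  | neg φ ih => exact not_congr ih
  | conj φ ψ ih₁ ih₂ => exact and_congr ih₁ ih₂
  | know φ ih => exact forall₂_congr fun v _ => ih
  | wh x φ ih =>
    have hsat : (fun (a : M.D) v => (M.expand f).Sat (φ.map f g) v (update σ (g x) a)) =
        fun a v => M.Sat φ v (update (σ ∘ g) x a) := by
      ext a v
      rw [← update_comp_eq_of_injective σ hg]
      exact ih
    change (M.expand f).KnowsWh op
      (fun (a : M.D) v => (M.expand f).Sat (φ.map f g) v (update σ (g x) a)) w ↔ _
    rw [hsat]
    cases op <;> exact Iff.rfl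

end KripkeModel

end Map

theorem provable_of_entails_empty [Infinite X] (hφ : Entails.{u, v, max u v, v} ∅ φ) :
    Provable φ := by
  let Y : Set X := φ.FV ∪ φ.BV ∪ Set.range (Infinite.natEmbedding X)
  have : Countable Y := ((φ.finite_FV.union φ.finite_BV).countable.union
    (Set.countable_range _)).to_subtype
  have : Infinite Y := ((Set.infinite_range_of_injective (Infinite.natEmbedding X).injective).mono
    Set.subset_union_right).to_subtype
  have : Countable φ.preds := φ.finite_preds.countable.to_subtype
  obtain ⟨ψ, hψ⟩ := exists_map_eq (f := ((↑) : φ.preds → P)) (g := ((↑) : Y → X)) (φ := φ)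
    (by simp)
    (by rw [Subtype.range_coe]; exact Set.subset_union_left.trans Set.subset_union_left)
    (by rw [Subtype.range_coe]; exact Set.subset_union_right.trans Set.subset_union_left)
  refine hψ ▸ Provable.map Subtype.val_injective (provable_of_entails_empty_of_countable ?_)
  intro M hM w σ _
  let τ : X → M.D := extend Subtype.val σ fun _ => M.nonempty_D.some
  have hτ : τ ∘ Subtype.val = σ := extend_comp Subtype.val_injective _ _
  rw [← hτ, ← KripkeModel.sat_expand_map Subtype.val_injective Subtype.val_injective, hψ]
  exact hφ (M.expand _) hM.expand w τ (by simp)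

/-! ### Compactness -/

namespace KripkeModel

open Filter

universe w₃

variable {I : Type w₃} {U : Ultrafilter I} {M : I → KripkeModel.{u, w₁, w₂} ar}

/-- The ultraproduct of a family of models; only the domain is divided by almost everywhere
equality, the worlds are all choices of worlds of the factors. -/
def ultraproduct (U : Ultrafilter I) (M : I → KripkeModel.{u, w₁, w₂} ar) :
    KripkeModel.{u, max w₃ w₁, max w₃ w₂} ar where
  W := ∀ i, (M i).W
  D := (U : Filter I).Product fun i => (M i).D
  nonempty_W := ⟨fun i => (M i).nonempty_W.some⟩
  nonempty_D := ⟨Quotient.mk _ fun i => (M i).nonempty_D.some⟩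
  R w v := ∀ᶠ i in U, (M i).R (w i) (v i)
  ρ p w := {d | ∃ t : Fin (ar p) → ∀ i, (M i).D, (∀ j, d j = Quotient.mk _ (t j)) ∧
    ∀ᶠ i in U, (fun j => t j i) ∈ (M i).ρ p (w i)}

theorem isS42_ultraproduct (hM : ∀ i, (M i).IsS42) : (ultraproduct U M).IsS42 where
  refl w := .of_forall fun i => (hM i).refl (w i)
  trans w v u hwv hvu := by
    filter_upwards [hwv, hvu] with i hwv hvu using (hM i).trans _ _ _ hwv hvu
  conv w := by
    choose u hu using fun i => (hM i).conv (w i)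
    exact ⟨u, fun v hv => hv.mono fun i hi => hu i _ hi⟩

theorem forall_eventually_iff {α : I → Type*} [∀ i, Nonempty (α i)] {q : ∀ i, α i → Prop} :
    (∀ a : ∀ i, α i, ∀ᶠ i in U, q i (a i)) ↔ ∀ᶠ i in U, ∀ a, q i a := by
  rw [← not_iff_not, ← Ultrafilter.eventually_not]
  simp only [not_forall, ← Ultrafilter.eventually_not, Filter.skolem]

/-- The statement of Łoś's theorem for the formula `φ`. -/
def LosTheorem (U : Ultrafilter I) (M : I → KripkeModel.{u, w₁, w₂} ar)
    (φ : Formula ar X op ident) : Prop :=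
  ∀ (w : ∀ i, (M i).W) (σ : X → ∀ i, (M i).D),
    (ultraproduct U M).Sat φ w (fun x => Quotient.mk _ (σ x)) ↔
      ∀ᶠ i in U, (M i).Sat φ (w i) fun x => σ x i

namespace LosTheorem

theorem atom (p : P) (t : Fin (ar p) → X) :
    LosTheorem U M (.atom p t : Formula ar X op ident) := by
  refine fun w σ => ⟨fun ⟨s, hs, hρ⟩ => ?_, fun h => ⟨fun j => σ (t j), fun _ => rfl, h⟩⟩
  have hσ : ∀ᶠ i in U, ∀ j, σ (t j) i = s j i := eventually_all.2 fun j => Quotient.exact (hs j)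
  filter_upwards [hρ, hσ] with i hρ hσ
  simpa only [Sat, hσ] using hρ

theorem isModallyClosed :
    IsModallyClosed (LosTheorem U M : Formula ar X op ident → Prop) where
  neg hφ w σ := (not_congr (hφ w σ)).trans Ultrafilter.eventually_not.symm
  conj hφ hψ w σ := (and_congr (hφ w σ) (hψ w σ)).trans eventually_and.symm
  know {φ} hφ w σ := by
    have := fun i => (M i).nonempty_W
    refine .trans (forall_congr' fun v => ?_) forall_eventually_iff
    exact (imp_congr_right fun _ => hφ v σ).trans Ultrafilter.eventually_imp.symm

theorem sat_update {x : X} (hφ : LosTheorem U M φ) (w : ∀ i, (M i).W)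
    (σ : X → ∀ i, (M i).D) (a : ∀ i, (M i).D) :
    (ultraproduct U M).Sat φ w (update (fun y => Quotient.mk _ (σ y)) x (Quotient.mk _ a)) ↔
      ∀ᶠ i in U, (M i).Sat φ (w i) (update (fun y => σ y i) x (a i)) := by
  have hM (i : I) : update (fun y => σ y i) x (a i) = fun y => update σ x a y i :=
    (comp_update (fun b : ∀ i, (M i).D => b i) σ x a).symm
  simp only [hM, ← hφ w]
  exact iff_of_eq (congrArg _ (comp_update (Quotient.mk _) σ x a).symm)

theorem wh (x : X) (hφ : LosTheorem U M φ) : LosTheorem U M (.wh x φ) := by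
  intro w σ
  have := fun i => (M i).nonempty_D
  have hattitude := (isModallyClosed.attitude hφ).sat_update (x := x) w σ
  have himp := (isModallyClosed.imp (isModallyClosed.bel hφ) hφ).sat_update (x := x) w σ
  refine sat_wh.trans ?_
  simp only [sat_wh, eventually_and, eventually_imp_distrib_left, Filter.skolem,
    ← forall_eventually_iff, ← hattitude, ← himp]
  exact and_congr Quotient.mk_surjective.exists
    (imp_congr_right fun _ => Quotient.mk_surjective.forall)

end LosTheorem

theorem losTheorem (φ : Formula ar X op ident) : LosTheorem U M φ := by
  induction φ with
  | atom p t => exact .atom p t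
  | eq _ x y => exact fun _ _ => Quotient.eq
  | neg φ ih => exact LosTheorem.isModallyClosed.neg ih
  | conj φ ψ ih₁ ih₂ => exact LosTheorem.isModallyClosed.conj ih₁ ih₂
  | know φ ih => exact LosTheorem.isModallyClosed.know ih
  | wh x φ ih => exact ih.wh x

end KripkeModel

variable {Γ : Set (Formula ar X op ident)}

theorem Entails.exists_finset (h : Entails.{u, v, max u v w₁, max u v w₂} Γ φ) :
    ∃ s : Finset Γ, Entails.{u, v, w₁, w₂} ((↑) '' (s : Set Γ)) φ := by
  by_contra! hn
  simp only [Entails, Set.forall_mem_image, Finset.mem_coe, not_forall] at hn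
  choose M hM w σ hΓ hφ using hn
  let U : Ultrafilter (Finset Γ) := .of .atTop
  have hsat := h (.ultraproduct U M) (KripkeModel.isS42_ultraproduct hM) w
    (fun x => Quotient.mk _ fun s => σ s x) fun γ hγ => by
      refine (KripkeModel.losTheorem γ w fun x s => σ s x).2 (.filter_mono (Ultrafilter.of_le _) ?_)
      filter_upwards [Filter.eventually_ge_atTop {⟨γ, hγ⟩}] with s hs
      exact hΓ s (Finset.singleton_subset_iff.1 hs)
  obtain ⟨s, hs⟩ := ((KripkeModel.losTheorem φ w fun x s => σ s x).1 hsat).exists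
  exact hφ s hs

theorem derives_of_entails [Infinite X] (h : Entails.{u, v, max u v, max u v} Γ φ) :
    Derives Γ φ := by
  obtain ⟨s, hs⟩ := Entails.exists_finset.{u, v, max u v, v} h
  refine ⟨s.toList.map (↑), by simp +contextual, provable_of_entails_empty fun M hM w σ _ => ?_⟩
  refine KripkeModel.sat_foldr_imp.2 fun hsat => hs M hM w σ ?_
  simpa using hsat

end KnowWh

theorem mainTheorem1 {P : Type u} (ar : P → ℕ) (X : Type v) [DecidableEq X] [Infinite X]
    (op : KnowWh.WhOp) (ident : Bool) :
    -- soundness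
    (∀ (Γ : Set (KnowWh.Formula ar X op ident)) (φ : KnowWh.Formula ar X op ident),
      KnowWh.Derives Γ φ → KnowWh.Entails.{u, v, w₁, w₂} Γ φ) ∧
    -- strong completeness
    (∀ (Γ : Set (KnowWh.Formula ar X op ident)) (φ : KnowWh.Formula ar X op ident),
      KnowWh.Entails.{u, v, max u v, max u v} Γ φ → KnowWh.Derives Γ φ) :=
  ⟨fun _ _ => KnowWh.entails_of_derives, fun _ _ => KnowWh.derives_of_entails⟩
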